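/- Let $\mathbb D\subset\mathbb C$ be the open unit disc, $d\mu=(1-|z|^2)^{-2}\,dA$ its hyperbolic measure ($dA$ Lebesgue measure), and for $\alpha>-1$ let $\mathbf B^2_\alpha$ be the space of holomorphic $f$ on $\mathbb D$ with $\|f\|^2:=\int_{\mathbb D}|f|^2(1-|z|^2)^{\alpha}\,dA<\infty$. Put $\mathbf f_\omega(z)=\sqrt{\tfrac{\alpha+1}{\pi}}\,(1-|\omega|^2)^{(\alpha+2)/2}(1-\overline\omega z)^{-(\alpha+2)}$ for $\omega\in\mathbb D$, $\theta_\alpha(s)=1-(1+\tfrac s\pi)^{-\alpha-1}$, and for $0\neq f\in\mathbf B_\alpha^2$ and measurable $\Omega\subset\mathbb D$ with $\mu(\Omega)=s\in(0,\infty)$, $$D_\alpha(f)=\inf_{|c|=\|f\|,\ \omega\in\mathbb D}\frac{\|f-c\,\mathbf f_\omega\|}{\|f\|},\qquad \delta(f;\Omega,\alpha)=\frac{\|f\|^2\theta_\alpha(s)-\int_\Omega|f|^2(1-|z|^2)^{\alpha+2}\,d\mu}{\|f\|^2\theta_\alpha(s)},$$ $$\mathcal A(\Omega)=\inf\Big\{\tfrac{\mu(\Omega\triangle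 B)}{\mu(\Omega)}: B\subset\mathbb D\text{ a pseudohyperbolic disc},\ \mu(B)=\mu(\Omega)\Big\},$$ $$\Sigma(c,\alpha)(s)=\Big(1+\tfrac{\alpha+2}{\alpha+1}\big[(1+c\tfrac s\pi)^{\alpha+1}-1\big]\Big)^{1/2},$$ where the square root is read as $0$ if the radicand is negative (which can happen only for $c<0$). The function and set stability estimates are $D_\alpha(f)\le C\,\Sigma(1,\alpha)(s)\,\delta(f;\Omega,\alpha)^{1/2}$, with $C$ absolute, and $\mathcal A(\Omega)\le K(s,\alpha)\,\delta(f;\Omega,\alpha)^{1/2}$. They are sharp in the following sense. (i) Let $\alpha>-1$, $\beta>\frac12$ and $s>0$. There is no constant $K$ such that $D_\alpha(f)\le K\,\delta(f;\Omega,\alpha)^\beta$ for all measurable $\Omega\subset\mathbb D$ with $\mu(\Omega)=s$ and all $0\ne f\in\mathbf B^2_\alpha$, and there is no constant $K$ such that $\mathcal A(\Omega)\le K\,\delta(f;\Omega,\alpha)^\beta$ for all such $\Omega$ and $f$. (ii) There are no $c<1$ and $C$ such that, for all sufficiently large $\alpha$, $D_\alpha(f)\le C\,\Sigma(c,\alpha)(s)\,\delta(f;\Omega,\alpha)^{1/2}$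 for all $s>0$, all measurable $\Omega\subset\mathbb D$ with $\mu(\Omega)=s$ and all $0\neq f\in\mathbf B^2_\alpha$. Moreover, for a given $\alpha>-1$, if this estimate holds (for all such $s,\Omega,f$) with some real $c$ and some $C>0$, then $$c\ \ge\ \Big(\frac{C^2(\alpha+2)}{2}\Big)^{-\frac1{\alpha+1}},$$ and if it holds with $C=1$, then also $c\ge\big(\frac{\pi(\alpha+2)}{\alpha+1}\big)^{-\frac{1}{\alpha+1}}$. (iii) Let $c_n=\int_{\mathbb D}|z|^{2n}(1-|z|^2)^\alpha\,dA$, let $f_{\alpha,\varepsilon}(z)=\frac1{\sqrt{c_0}}+\frac{\varepsilon}{\sqrt{c_2}}z^2$, a nonzero element of $\mathbf B^2_\alpha$, and let $B_s$ be the disc centred at $0$ of radius $\sqrt{s/(s+\pi)}$, so that $\mu(B_s)=s$. There are absolute constants $0<a\le b$ such that for every $s>0$ there is $\kappa(s)\in[a,b]$ with $$\frac{D_\alpha(f_{\alpha,\varepsilon})}{\varepsilon}\to1\qquad\text{and}\qquad\frac{\Sigma(1,\alpha)(s)\,\delta(f_{\alpha,\varepsilon};B_s,\alpha)^{1/2}}{\varepsilon}\to\kappa(s)$$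 as $(\alpha,\varepsilon)\to(-1,0)$ jointly with $\alpha>-1$, $\varepsilon>0$; that is, both sides of the function estimate behave like a constant times $\varepsilon$. -/

import Mathlib

open MeasureTheory Filter Set Topology

noncomputable section

namespace BergmanStability

/-- The open unit disc `𝔻`. -/
def disc : Set ℂ := Metric.ball 0 1

/-- The hyperbolic measure `dμ = (1 - |z|²)⁻² dA` on the unit disc, `dA` being Lebesgue measure. -/
def hypMeasure : Measure ℂ :=
  (volume.restrict disc).withDensity (fun z => ENNReal.ofReal (((1 - ‖z‖ ^ 2) ^ 2)⁻¹))

/-- Membership in the weighted Bergman space: holomorphic in the disc and square integrable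
with respect to `(1 - |z|²)^α dA`. -/
def MemBergman (α : ℝ) (f : ℂ → ℂ) : Prop :=
  DifferentiableOn ℂ f disc ∧
    IntegrableOn (fun z => ‖f z‖ ^ 2 * (1 - ‖z‖ ^ 2) ^ α) disc volume

/-- The weighted Bergman norm. -/
def bergmanNorm (α : ℝ) (f : ℂ → ℂ) : ℝ :=
  Real.sqrt (∫ z in disc, ‖f z‖ ^ 2 * (1 - ‖z‖ ^ 2) ^ α)

/-- The normalized reproducing kernel
`f_ω(z) = √((α+1)/π) (1-|ω|²)^((α+2)/2) (1 - ω̄ z)^(-(α+2))`. The principal branch is meant;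
`1 - ω̄ z` has positive real part for `z, ω` in the disc. -/
def kernelFun (α : ℝ) (ω z : ℂ) : ℂ :=
  ((Real.sqrt ((α + 1) / Real.pi) * (1 - ‖ω‖ ^ 2) ^ ((α + 2) / 2) : ℝ) : ℂ) /
    (1 - (starRingEnd ℂ) ω * z) ^ ((α + 2 : ℝ) : ℂ)

/-- `inf ‖f - c f_ω‖ / ‖f‖` over `|c| = ‖f‖` and `ω` in the disc. -/
def extremalDist (α : ℝ) (f : ℂ → ℂ) : ℝ :=
  sInf {d : ℝ | ∃ c ω : ℂ, ‖c‖ = bergmanNorm α f ∧ ω ∈ disc ∧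
    d = bergmanNorm α (fun z => f z - c * kernelFun α ω z) / bergmanNorm α f}

/-- `θ_α(s) = 1 - (1 + s/π)^(-α-1)`. -/
def theta (α s : ℝ) : ℝ := 1 - (1 + s / Real.pi) ^ (-α - 1)

/-- The deficit `δ(f; Ω, α)`. -/
def deficit (α : ℝ) (f : ℂ → ℂ) (Ω : Set ℂ) : ℝ :=
  (bergmanNorm α f ^ 2 * theta α (hypMeasure.real Ω)
      - ∫ z in Ω, ‖f z‖ ^ 2 * (1 - ‖z‖ ^ 2) ^ (α + 2) ∂hypMeasure) /
    (bergmanNorm α f ^ 2 * theta α (hypMeasure.real Ω))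

/-- The pseudohyperbolic disc with centre `x` and radius `r`. -/
def hypDisc (x : ℂ) (r : ℝ) : Set ℂ :=
  {z | z ∈ disc ∧ ‖z - x‖ < r * ‖1 - (starRingEnd ℂ) x * z‖}

/-- The hyperbolic asymmetry of `Ω`. -/
def asymmetry (Ω : Set ℂ) : ℝ :=
  sInf {d : ℝ | ∃ (x : ℂ) (r : ℝ), x ∈ disc ∧ hypMeasure (hypDisc x r) = hypMeasure Ω ∧
    d = hypMeasure.real (symmDiff Ω (hypDisc x r)) / hypMeasure.real Ω}

/-- The function estimate `inf ‖f - c f_ω‖ / ‖f‖ ≤ K δ(f; Ω, α)^β`, for all sets `Ω` of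
hyperbolic measure `s` and all nonzero `f` in the Bergman space. -/
def FunctionEstimate (α s K β : ℝ) : Prop :=
  ∀ Ω : Set ℂ, MeasurableSet Ω → Ω ⊆ disc → hypMeasure Ω = ENNReal.ofReal s →
    ∀ f : ℂ → ℂ, MemBergman α f → 0 < bergmanNorm α f →
      extremalDist α f ≤ K * deficit α f Ω ^ β

/-- The set estimate `𝒜(Ω) ≤ K δ(f; Ω, α)^β`, for all sets `Ω` of hyperbolic measure `s`
and all nonzero `f` in the Bergman space. -/
def SetEstimate (α s K β : ℝ) : Prop :=
  ∀ Ω : Set ℂ, MeasurableSet Ω → Ω ⊆ disc → hypMeasure Ω = ENNReal.ofReal s →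
    ∀ f : ℂ → ℂ, MemBergman α f → 0 < bergmanNorm α f →
      asymmetry Ω ≤ K * deficit α f Ω ^ β

/-- `Σ(c, α)` at the measure `s`; for `c = 1` it is the constant of the function estimate,
up to an absolute factor. -/
def sigmaConst (c α s : ℝ) : ℝ :=
  Real.sqrt (1 + (α + 2) / (α + 1) * ((1 + c * (s / Real.pi)) ^ (α + 1) - 1))

/-- `c_n = ‖zⁿ‖²` in the Bergman space. -/
def monomialConst (α : ℝ) (n : ℕ) : ℝ :=
  ∫ z in disc, ‖z‖ ^ (2 * n) * (1 - ‖z‖ ^ 2) ^ α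

/-- `f_{α,ε}(z) = 1/√c₀ + (ε/√c₂) z²`. -/
def testFun (α ε : ℝ) (z : ℂ) : ℂ :=
  ((1 / Real.sqrt (monomialConst α 0) : ℝ) : ℂ) +
    ((ε / Real.sqrt (monomialConst α 2) : ℝ) : ℂ) * z ^ 2

/-- The disc centred at the origin of hyperbolic measure `s`. -/
def centredDisc (s : ℝ) : Set ℂ := Metric.ball 0 (Real.sqrt (s / (s + Real.pi)))

end BergmanStability

end

/-!
Orthogonality of monomials shows that, for small `ε`, the inner products of `testFun α ε` with the
normalised kernels have modulus at most `1`, with equality at `ω = 0`. As the norm of `testFun α ε`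
is `√(1 + ε²)`, its squared distance to the extremals is `2 - 2 / √(1 + ε²)`, which behaves like
`ε²`, whereas on a centred disc the deficit is an explicit multiple of `ε²`: no exponent above `1/2`
is possible. For sets, one moves an annulus of measure `η` across the boundary of a disc, so that
the asymmetry is linear in `η` while the deficit of a constant function is a second difference of
`theta`, hence quadratic.

To bound `c`, one tests with a disc deformed towards the superlevel sets of
`|testFun α ε|² (1 - |z|²)^(α + 2)`. First `s → ∞` and then `ε → 0` give
`1 ≤ C² (α + 2) / 2 * c^(α + 1)`. Letting `s → 0` on centred discs gives `1 < C²`, so the estimate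
never holds with `C = 1`.
-/

noncomputable section

namespace BergmanStability

open scoped Real ComplexConjugate ENNReal

/-! ### Integration in polar coordinates -/

theorem polarCoord_symm_eq_circleMap (p : ℝ × ℝ) :
    Complex.polarCoord.symm p = circleMap 0 p.1 p.2 := by
  simp [circleMap, Complex.exp_mul_I]

theorem arg_circleMap_zero {r θ : ℝ} (hr : 0 < r) (hθ : θ ∈ Ioc (-π) π) :
    Complex.arg (circleMap 0 r θ) = θ := by
  rw [circleMap_zero, Complex.arg_real_mul _ hr, Complex.arg_exp_mul_I,
    toIocMod_eq_self, show -π + 2 * π = π by ring]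
  exact hθ

theorem continuous_uncurry_circleMap_zero :
    Continuous fun p : ℝ × ℝ => circleMap 0 p.1 p.2 := by
  unfold circleMap
  fun_prop

/-- The region bounded by the polar curve `r = ρ θ`, in terms of the principal argument. -/
def starRegion (ρ : ℝ → ℝ) : Set ℂ := {z | ‖z‖ < ρ (Complex.arg z)}

theorem measurableSet_starRegion {ρ : ℝ → ℝ} (hρ : Measurable ρ) : MeasurableSet (starRegion ρ) :=
  measurableSet_lt measurable_norm (hρ.comp Complex.measurable_arg)

theorem starRegion_const (R : ℝ) : starRegion (fun _ => R) = Metric.ball 0 R := by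
  ext z
  simp [starRegion]

theorem circleMap_mem_starRegion {ρ : ℝ → ℝ} {r θ : ℝ} (hr : 0 < r) (hθ : θ ∈ Ioc (-π) π) :
    circleMap 0 r θ ∈ starRegion ρ ↔ r < ρ θ := by
  rw [starRegion, mem_ofPred_eq, norm_circleMap_zero, abs_of_pos hr, arg_circleMap_zero hr hθ]

theorem lintegral_starRegion {F : ℂ → ℝ≥0∞} (hF : Measurable F) {ρ : ℝ → ℝ} (hρ : Measurable ρ) :
    ∫⁻ z in starRegion ρ, F z =
      ∫⁻ θ in Ioo (-π) π, ∫⁻ r in Ioo 0 (ρ θ), ENNReal.ofReal r * F (circleMap 0 r θ) := by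
  let S : Set (ℝ × ℝ) := {p | p.1 < ρ p.2}
  let f : ℝ × ℝ → ℝ≥0∞ := fun p => ENNReal.ofReal p.1 * F (circleMap 0 p.1 p.2)
  have hS : MeasurableSet S := measurableSet_lt measurable_fst (hρ.comp measurable_snd)
  have hf : Measurable f :=
    measurable_fst.ennreal_ofReal.mul (hF.comp continuous_uncurry_circleMap_zero.measurable)
  have hpolar : ∀ p ∈ Ioi (0 : ℝ) ×ˢ Ioo (-π) π,
      ENNReal.ofReal p.1 • (starRegion ρ).indicator F (Complex.polarCoord.symm p) =
        S.indicator f p := by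
    rintro ⟨r, θ⟩ ⟨hr, hθ⟩
    have hmem : circleMap 0 r θ ∈ starRegion ρ ↔ (r, θ) ∈ S :=
      circleMap_mem_starRegion hr (Ioo_subset_Ioc_self hθ)
    rw [polarCoord_symm_eq_circleMap]
    by_cases h : (r, θ) ∈ S <;> simp [indicator, hmem, h, f]
  have hslice : ∀ θ r, S.indicator f (r, θ) = (Iio (ρ θ)).indicator (fun r => f (r, θ)) r :=
    fun θ r => by simp [indicator, S]
  rw [← lintegral_indicator (measurableSet_starRegion hρ),
    ← Complex.lintegral_comp_polarCoord_symm, polarCoord_target,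
    setLIntegral_congr_fun (measurableSet_Ioi.prod measurableSet_Ioo) hpolar,
    Measure.volume_eq_prod, ← Measure.prod_restrict,
    lintegral_prod_symm _ (hf.indicator hS).aemeasurable]
  simp only [hslice, lintegral_indicator measurableSet_Iio,
    Measure.restrict_restrict measurableSet_Iio, Iio_inter_Ioi, f]

theorem integrableOn_polarCoord_target_of_integrable {E : Type*} [NormedAddCommGroup E]
    [NormedSpace ℝ E] {f : ℂ → E} (hf : Integrable f) :
    IntegrableOn (fun p => p.1 • f (Complex.polarCoord.symm p)) polarCoord.target := by
  have hprod : Integrable fun p => f (Complex.measurableEquivRealProd.symm p) :=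
    Complex.volume_preserving_equiv_real_prod.symm.integrable_comp_of_integrable hf
  have himage := (integrableOn_image_iff_integrableOn_abs_det_fderiv_smul volume
    polarCoord.open_target.measurableSet
    (fun p _ => (hasFDerivAt_polarCoord_symm p).hasFDerivWithinAt) polarCoord.symm.injOn _).1
    hprod.integrableOn
  refine himage.congr_fun (fun p hp => ?_) polarCoord.open_target.measurableSet
  have hp1 : 0 < p.1 := hp.1
  dsimp only
  rw [det_fderivPolarCoordSymm, abs_of_pos hp1,
    Complex.measurableEquivRealProd_symm_polarCoord_symm_apply]

theorem setIntegral_ball_eq_polar {E : Type*} [NormedAddCommGroup E] [NormedSpace ℝ E]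
    {f : ℂ → E} {R : ℝ} (hf : IntegrableOn f (Metric.ball 0 R)) :
    ∫ z in Metric.ball 0 R, f z =
      ∫ r in Ioo 0 R, r • ∫ θ in (-π)..π, f (circleMap 0 r θ) := by
  have hball : MeasurableSet (Metric.ball (0 : ℂ) R) := Metric.isOpen_ball.measurableSet
  have hpi : -π ≤ π := by linarith [Real.pi_pos]
  have hrect : MeasurableSet (Iio R ×ˢ (univ : Set ℝ)) := measurableSet_Iio.prod .univ
  have hpolar : EqOn (fun p : ℝ × ℝ => p.1 • (Metric.ball 0 R).indicator f
        (Complex.polarCoord.symm p))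
      ((Iio R ×ˢ univ).indicator fun p => p.1 • f (circleMap 0 p.1 p.2))
      (Ioi (0 : ℝ) ×ˢ Ioo (-π) π) := by
    rintro ⟨r, θ⟩ ⟨hr, -⟩
    have hr0 : 0 < r := hr
    dsimp only
    rw [polarCoord_symm_eq_circleMap]
    by_cases h : r < R <;> simp [indicator, abs_of_pos hr0, h]
  have hInt := (integrableOn_polarCoord_target_of_integrable
    ((integrable_indicator_iff hball).2 hf)).congr_fun hpolar
      (measurableSet_Ioi.prod measurableSet_Ioo)
  rw [← integral_indicator hball, ← Complex.integral_comp_polarCoord_symm, polarCoord_target,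
    setIntegral_congr_fun (measurableSet_Ioi.prod measurableSet_Ioo) hpolar,
    setIntegral_indicator hrect, prod_inter_prod, Ioi_inter_Iio, inter_univ,
    Measure.volume_eq_prod, setIntegral_prod]
  · refine setIntegral_congr_fun measurableSet_Ioo fun r _ => ?_
    rw [intervalIntegral.integral_of_le hpi, integral_Ioc_eq_integral_Ioo]
    exact integral_smul _ _
  · rw [polarCoord_target, IntegrableOn, integrable_indicator_iff hrect, IntegrableOn,
      Measure.restrict_restrict hrect, inter_comm, prod_inter_prod, Ioi_inter_Iio,
      inter_univ] at hInt
    exact hInt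

theorem lintegral_Ioo_of_hasDerivAt {G g : ℝ → ℝ} {a b : ℝ} (hab : a ≤ b)
    (hG : ContinuousOn G (Icc a b)) (hG' : ∀ x ∈ Ioo a b, HasDerivAt G (g x) x)
    (hg : ∀ x ∈ Ioo a b, 0 ≤ g x) :
    ∫⁻ x in Ioo a b, ENNReal.ofReal (g x) = ENNReal.ofReal (G b - G a) := by
  have hInt := intervalIntegral.integrableOn_deriv_of_nonneg hG hG' hg
  rw [← intervalIntegral.integral_eq_sub_of_hasDerivAt_of_le hab hG hG'
      ((intervalIntegrable_iff_integrableOn_Ioc_of_le hab).2 hInt),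
    intervalIntegral.integral_of_le hab, integral_Ioc_eq_integral_Ioo,
    ofReal_integral_eq_lintegral_ofReal (hInt.mono_set Ioo_subset_Ioc_self)]
  exact (ae_restrict_iff' measurableSet_Ioo).2 (ae_of_all _ hg)

theorem lintegral_Ioo_mul_comp_one_sub_sq {G g : ℝ → ℝ} {a : ℝ} (ha : a ≤ 1)
    (hG : ContinuousOn G (Icc a 1)) (hG' : ∀ t ∈ Ioo a 1, HasDerivAt G (g t) t)
    (hg : ∀ t ∈ Ioo a 1, 0 ≤ g t) :
    ∫⁻ r in Ioo 0 √(1 - a), ENNReal.ofReal (r * g (1 - r ^ 2)) =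
      ENNReal.ofReal ((G 1 - G a) / 2) := by
  have hsqrt : √(1 - a) ^ 2 = 1 - a := Real.sq_sqrt (by linarith)
  have hIoo : ∀ r ∈ Ioo 0 √(1 - a), 1 - r ^ 2 ∈ Ioo a 1 := fun r hr =>
    ⟨by linarith [pow_lt_pow_left₀ hr.2 hr.1.le two_ne_zero], by linarith [pow_pos hr.1 2]⟩
  have hIcc : MapsTo (fun r : ℝ => 1 - r ^ 2) (Icc 0 √(1 - a)) (Icc a 1) := fun r hr =>
    ⟨by linarith [pow_le_pow_left₀ hr.1 hr.2 2], by linarith [pow_nonneg hr.1 2]⟩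
  rw [lintegral_Ioo_of_hasDerivAt (G := fun r => -(G (1 - r ^ 2) / 2)) (Real.sqrt_nonneg _)]
  · congr 1
    simp only [hsqrt, sub_sub_cancel]
    ring_nf
  · exact ((hG.comp (by fun_prop) hIcc).div_const 2).neg
  · intro r hr
    have hinner : HasDerivAt (fun r : ℝ => 1 - r ^ 2) (-(2 * r)) r := by
      simpa using (hasDerivAt_pow 2 r).const_sub 1
    exact (((hG' _ (hIoo r hr)).comp r hinner).div_const 2).neg.congr_deriv (by ring)
  · exact fun r hr => mul_nonneg hr.1.le (hg _ (hIoo r hr))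

theorem lintegral_starRegion_of_hasDerivAt {F : ℂ → ℝ} (hF : Measurable F) {v : ℝ → ℝ}
    (hv : Measurable v) (hv1 : ∀ θ, v θ ≤ 1) {G g : ℝ → ℝ → ℝ}
    (hFg : ∀ θ, ∀ r ∈ Ioo 0 √(1 - v θ), F (circleMap 0 r θ) = g θ (1 - r ^ 2))
    (hG : ∀ θ, ContinuousOn (G θ) (Icc (v θ) 1))
    (hG' : ∀ θ, ∀ t ∈ Ioo (v θ) 1, HasDerivAt (G θ) (g θ t) t)
    (hg : ∀ θ, ∀ t ∈ Ioo (v θ) 1, 0 ≤ g θ t)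
    (hcont : Continuous fun θ => G θ 1 - G θ (v θ)) :
    ∫⁻ z in starRegion (fun θ => √(1 - v θ)), ENNReal.ofReal (F z) =
      ENNReal.ofReal (∫ θ in (-π)..π, (G θ 1 - G θ (v θ)) / 2) := by
  have hpi : -π ≤ π := by linarith [Real.pi_pos]
  have hmono : ∀ θ, 0 ≤ (G θ 1 - G θ (v θ)) / 2 := fun θ => by
    have h : MonotoneOn (G θ) (Icc (v θ) 1) := by
      refine monotoneOn_of_hasDerivWithinAt_nonneg (f' := g θ) (convex_Icc _ _) (hG θ) ?_ ?_ <;>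
        rw [interior_Icc]
      exacts [fun t ht => (hG' θ t ht).hasDerivWithinAt, hg θ]
    linarith [h (left_mem_Icc.2 (hv1 θ)) (right_mem_Icc.2 (hv1 θ)) (hv1 θ)]
  have hray : ∀ θ, ∫⁻ r in Ioo 0 √(1 - v θ),
      ENNReal.ofReal r * ENNReal.ofReal (F (circleMap 0 r θ)) =
        ENNReal.ofReal ((G θ 1 - G θ (v θ)) / 2) := fun θ => by
    rw [← lintegral_Ioo_mul_comp_one_sub_sq (hv1 θ) (hG θ) (hG' θ) (hg θ)]
    refine setLIntegral_congr_fun measurableSet_Ioo fun r hr => ?_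
    rw [← ENNReal.ofReal_mul hr.1.le, hFg θ r hr]
  rw [lintegral_starRegion hF.ennreal_ofReal (by fun_prop)]
  simp only [hray]
  rw [intervalIntegral.integral_of_le hpi, integral_Ioc_eq_integral_Ioo,
    ofReal_integral_eq_lintegral_ofReal]
  · exact (hcont.div_const 2).integrableOn_Icc.mono_set Ioo_subset_Icc_self
  · exact ae_of_all _ hmono

/-! ### The hyperbolic measure -/

theorem mem_disc {z : ℂ} : z ∈ disc ↔ ‖z‖ < 1 := by simp [disc]

theorem measurableSet_disc : MeasurableSet disc := Metric.isOpen_ball.measurableSet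

theorem one_sub_norm_sq_pos {z : ℂ} (hz : z ∈ disc) : 0 < 1 - ‖z‖ ^ 2 :=
  sub_pos.2 (pow_lt_one₀ (norm_nonneg z) (mem_disc.1 hz) two_ne_zero)

theorem mem_disc_of_one_sub_norm_sq_pos {z : ℂ} (h : 0 < 1 - ‖z‖ ^ 2) : z ∈ disc :=
  mem_disc.2 <| lt_of_pow_lt_pow_left₀ 2 zero_le_one (by linarith)

theorem starRegion_subset_disc {v : ℝ → ℝ} (hv0 : ∀ θ, 0 ≤ v θ) :
    starRegion (fun θ => √(1 - v θ)) ⊆ disc := fun z hz =>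
  mem_disc.2 (lt_of_lt_of_le hz (Real.sqrt_le_one.2 (by linarith [hv0 (Complex.arg z)])))

theorem lintegral_hypMeasure {F : ℂ → ℝ≥0∞} (hF : Measurable F) :
    ∫⁻ z, F z ∂hypMeasure = ∫⁻ z in disc, ENNReal.ofReal (((1 - ‖z‖ ^ 2) ^ 2)⁻¹) * F z := by
  rw [hypMeasure, lintegral_withDensity_eq_lintegral_mul _ (by fun_prop) hF]
  rfl

theorem hypMeasure_apply {Ω : Set ℂ} (hΩ : MeasurableSet Ω) (hd : Ω ⊆ disc) :
    hypMeasure Ω = ∫⁻ z in Ω, ENNReal.ofReal (((1 - ‖z‖ ^ 2) ^ 2)⁻¹) := by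
  rw [hypMeasure, withDensity_apply _ hΩ, Measure.restrict_restrict hΩ,
    inter_eq_self_of_subset_left hd]

theorem hypMeasure_disc_compl : hypMeasure discᶜ = 0 := by
  rw [hypMeasure, withDensity_apply _ measurableSet_disc.compl,
    Measure.restrict_restrict measurableSet_disc.compl]
  simp

theorem hypMeasure_starRegion {v : ℝ → ℝ} (hv : Continuous v) (hv0 : ∀ θ, 0 < v θ)
    (hv1 : ∀ θ, v θ ≤ 1) :
    hypMeasure (starRegion fun θ => √(1 - v θ)) =
      ENNReal.ofReal (∫ θ in (-π)..π, ((v θ)⁻¹ - 1) / 2) := by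
  have hinv : ∀ θ, ∀ t ∈ Icc (v θ) 1, HasDerivAt (fun t : ℝ => -t⁻¹) (t ^ 2)⁻¹ t :=
    fun θ t ht => (hasDerivAt_inv ((hv0 θ).trans_le ht.1).ne').neg.congr_deriv (neg_neg _)
  have hvinv : Continuous fun θ => (v θ)⁻¹ := hv.inv₀ fun θ => (hv0 θ).ne'
  rw [hypMeasure_apply (measurableSet_starRegion (by fun_prop))
      (starRegion_subset_disc fun θ => (hv0 θ).le),
    lintegral_starRegion_of_hasDerivAt (by fun_prop) hv.measurable hv1
      (G := fun _ t => -t⁻¹) (g := fun _ t => (t ^ 2)⁻¹)]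
  · simp [sub_eq_add_neg, add_comm]
  · simp
  · exact fun θ t ht => (hinv θ t ht).continuousAt.continuousWithinAt
  · exact fun θ t ht => hinv θ t (Ioo_subset_Icc_self ht)
  · exact fun θ t _ => by positivity
  · fun_prop

theorem hypMeasure_ball_sqrt {v : ℝ} (hv0 : 0 < v) (hv1 : v ≤ 1) :
    hypMeasure (Metric.ball 0 √(1 - v)) = ENNReal.ofReal (π * (v⁻¹ - 1)) := by
  rw [← starRegion_const,
    hypMeasure_starRegion (v := fun _ => v) continuous_const (fun _ => hv0) (fun _ => hv1),
    intervalIntegral.integral_const, smul_eq_mul]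
  ring_nf

theorem one_add_div_pi_inv_mem_Ioo {s : ℝ} (hs : 0 < s) : (1 + s / π)⁻¹ ∈ Ioo (0 : ℝ) 1 := by
  have h : 0 < s / π := by positivity
  exact ⟨by positivity, inv_lt_one_of_one_lt₀ (by linarith)⟩

theorem centredDisc_eq {s : ℝ} (hs : 0 < s) :
    centredDisc s = Metric.ball 0 √(1 - (1 + s / π)⁻¹) := by
  have h : s / (s + π) = 1 - (1 + s / π)⁻¹ := by field
  rw [centredDisc, h]

theorem hypMeasure_centredDisc {s : ℝ} (hs : 0 < s) :
    hypMeasure (centredDisc s) = ENNReal.ofReal s := by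
  have hu := one_add_div_pi_inv_mem_Ioo hs
  rw [centredDisc_eq hs, hypMeasure_ball_sqrt hu.1 hu.2.le, inv_inv]
  congr 1
  field

/-- The disc automorphism exchanging `0` and `x`, an involution of the disc. -/
def moebius (x z : ℂ) : ℂ := (x - z) / (1 - conj x * z)

theorem measurable_moebius (x : ℂ) : Measurable (moebius x) := by
  unfold moebius
  fun_prop

theorem re_one_sub_conj_mul_pos {x z : ℂ} (hx : x ∈ disc) (hz : z ∈ disc) :
    0 < (1 - conj x * z).re := by
  have hnorm : ‖conj x * z‖ < 1 := by
    rw [norm_mul, RCLike.norm_conj]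
    exact mul_lt_one_of_nonneg_of_lt_one_left (norm_nonneg _) (mem_disc.1 hx) (mem_disc.1 hz).le
  rw [Complex.sub_re, Complex.one_re]
  linarith [Complex.re_le_norm (conj x * z)]

theorem one_sub_conj_mul_ne_zero {x z : ℂ} (hx : x ∈ disc) (hz : z ∈ disc) :
    1 - conj x * z ≠ 0 := fun h => by
  simpa [h] using re_one_sub_conj_mul_pos hx hz

theorem norm_sq_one_sub_conj_mul (x z : ℂ) :
    ‖1 - conj x * z‖ ^ 2 - ‖x - z‖ ^ 2 = (1 - ‖x‖ ^ 2) * (1 - ‖z‖ ^ 2) := by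
  simp only [← Complex.normSq_eq_norm_sq, Complex.normSq_apply, Complex.sub_re, Complex.sub_im,
    Complex.mul_re, Complex.mul_im, Complex.conj_re, Complex.conj_im, Complex.one_re,
    Complex.one_im]
  ring

theorem one_sub_norm_moebius_sq {x z : ℂ} (hx : x ∈ disc) (hz : z ∈ disc) :
    1 - ‖moebius x z‖ ^ 2 = (1 - ‖x‖ ^ 2) * (1 - ‖z‖ ^ 2) / ‖1 - conj x * z‖ ^ 2 := by
  have hden : ‖1 - conj x * z‖ ≠ 0 := norm_ne_zero_iff.2 (one_sub_conj_mul_ne_zero hx hz)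
  rw [← norm_sq_one_sub_conj_mul, moebius, norm_div, div_pow, sub_div,
    div_self (pow_ne_zero 2 hden)]

theorem moebius_mem_disc {x z : ℂ} (hx : x ∈ disc) (hz : z ∈ disc) : moebius x z ∈ disc := by
  refine mem_disc_of_one_sub_norm_sq_pos ?_
  rw [one_sub_norm_moebius_sq hx hz]
  exact div_pos (mul_pos (one_sub_norm_sq_pos hx) (one_sub_norm_sq_pos hz))
    (pow_pos (norm_pos_iff.2 (one_sub_conj_mul_ne_zero hx hz)) 2)

theorem moebius_moebius {x z : ℂ} (hx : x ∈ disc) (hz : z ∈ disc) :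
    moebius x (moebius x z) = z := by
  have hmul : moebius x z * (1 - conj x * z) = x - z :=
    div_mul_cancel₀ _ (one_sub_conj_mul_ne_zero hx hz)
  rw [moebius, div_eq_iff (one_sub_conj_mul_ne_zero hx (moebius_mem_disc hx hz))]
  linear_combination -hmul

theorem injOn_moebius {x : ℂ} (hx : x ∈ disc) : InjOn (moebius x) disc :=
  LeftInvOn.injOn (f₁' := moebius x) fun _ hz => moebius_moebius hx hz

theorem image_moebius_disc {x : ℂ} (hx : x ∈ disc) : moebius x '' disc = disc :=
  Subset.antisymm (image_subset_iff.2 fun _ hz => moebius_mem_disc hx hz)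
    fun z hz => ⟨moebius x z, moebius_mem_disc hx hz, moebius_moebius hx hz⟩

theorem hasDerivAt_moebius {x z : ℂ} (hx : x ∈ disc) (hz : z ∈ disc) :
    HasDerivAt (moebius x) (-((1 - ‖x‖ ^ 2 : ℝ) : ℂ) / (1 - conj x * z) ^ 2) z := by
  have hnum : HasDerivAt (fun z => x - z) (-1) z := (hasDerivAt_id z).const_sub x
  have hden : HasDerivAt (fun z => 1 - conj x * z) (-conj x) z := by
    simpa using ((hasDerivAt_id z).const_mul (conj x)).const_sub 1
  refine (hnum.div hden (one_sub_conj_mul_ne_zero hx hz)).congr_deriv ?_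
  have hnorm : x * conj x = (‖x‖ : ℂ) ^ 2 := Complex.mul_conj' x
  congr 1
  push_cast
  linear_combination hnorm

theorem det_restrictScalars_toSpanSingleton (d : ℂ) :
    ((ContinuousLinearMap.toSpanSingleton ℂ d).restrictScalars ℝ).det = ‖d‖ ^ 2 := by
  change LinearMap.det ((LinearMap.toSpanSingleton ℂ ℂ d).restrictScalars ℝ) = _
  rw [LinearMap.det_restrictScalars, Algebra.norm_complex_eq]
  simp [Complex.normSq_eq_norm_sq]

theorem abs_det_fderiv_moebius_mul_density {x z : ℂ} (hx : x ∈ disc) (hz : z ∈ disc) :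
    |‖-((1 - ‖x‖ ^ 2 : ℝ) : ℂ) / (1 - conj x * z) ^ 2‖ ^ 2| *
        ((1 - ‖moebius x z‖ ^ 2) ^ 2)⁻¹ = ((1 - ‖z‖ ^ 2) ^ 2)⁻¹ := by
  have hden := norm_pos_iff.2 (one_sub_conj_mul_ne_zero hx hz)
  have hx' := one_sub_norm_sq_pos hx
  have hz' := one_sub_norm_sq_pos hz
  rw [one_sub_norm_moebius_sq hx hz, abs_of_nonneg (sq_nonneg _), norm_div, norm_pow, norm_neg,
    Complex.norm_real, Real.norm_of_nonneg hx'.le]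
  field_simp

theorem lintegral_comp_moebius {F : ℂ → ℝ≥0∞} (hF : Measurable F) {x : ℂ} (hx : x ∈ disc) :
    ∫⁻ z, F (moebius x z) ∂hypMeasure = ∫⁻ z, F z ∂hypMeasure := by
  rw [lintegral_hypMeasure hF,
    lintegral_hypMeasure (F := fun z => F (moebius x z)) (hF.comp (measurable_moebius x))]
  conv_rhs => rw [← image_moebius_disc hx]
  rw [lintegral_image_eq_lintegral_abs_det_fderiv_mul volume measurableSet_disc
    (fun z hz => ((hasDerivAt_moebius hx hz).hasFDerivAt.restrictScalars ℝ).hasFDerivWithinAt)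
    (injOn_moebius hx)]
  refine setLIntegral_congr_fun measurableSet_disc fun z hz => ?_
  rw [← mul_assoc, det_restrictScalars_toSpanSingleton, ← ENNReal.ofReal_mul (abs_nonneg _),
    abs_det_fderiv_moebius_mul_density hx hz]

theorem hypDisc_eq_preimage {x : ℂ} (hx : x ∈ disc) (r : ℝ) :
    hypDisc x r = disc ∩ moebius x ⁻¹' Metric.ball 0 r := by
  ext z
  simp only [hypDisc, mem_ofPred_eq, mem_inter_iff, mem_preimage, Metric.mem_ball,
    dist_zero_right]
  refine and_congr_right fun hz => ?_
  rw [moebius, norm_div, div_lt_iff₀ (norm_pos_iff.2 (one_sub_conj_mul_ne_zero hx hz)),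
    norm_sub_rev]

theorem hypMeasure_hypDisc {x : ℂ} (hx : x ∈ disc) (r : ℝ) :
    hypMeasure (hypDisc x r) = hypMeasure (Metric.ball 0 r) := by
  have hball : MeasurableSet (Metric.ball (0 : ℂ) r) := Metric.isOpen_ball.measurableSet
  rw [hypDisc_eq_preimage hx, inter_comm, measure_inter_conull hypMeasure_disc_compl,
    ← lintegral_indicator_one (measurable_moebius x hball), ← lintegral_indicator_one hball,
    ← lintegral_comp_moebius (measurable_one.indicator hball) hx]
  rfl

/-- The primitive of `v ^ α * (A + B (1 - v) + C (1 - v) ^ 2)` vanishing at `0`, where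
`v = 1 - r²` is the radial variable of the disc. -/
def radialPrim (α A B C v : ℝ) : ℝ :=
  (A + B + C) * (v ^ (α + 1) / (α + 1)) - (B + 2 * C) * (v ^ (α + 2) / (α + 2)) +
    C * (v ^ (α + 3) / (α + 3))

theorem hasDerivAt_radialPrim {α : ℝ} (hα : -1 < α) (A B C : ℝ) {v : ℝ} (hv : 0 < v) :
    HasDerivAt (radialPrim α A B C) (v ^ α * (A + B * (1 - v) + C * (1 - v) ^ 2)) v := by
  have hpow : ∀ β : ℝ, 0 < β → HasDerivAt (fun v => v ^ β / β) (v ^ (β - 1)) v := fun β hβ =>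
    ((Real.hasDerivAt_rpow_const (Or.inl hv.ne')).div_const β).congr_deriv
      (mul_div_cancel_left₀ _ hβ.ne')
  refine ((((hpow (α + 1) (by linarith)).const_mul (A + B + C)).sub
    ((hpow (α + 2) (by linarith)).const_mul (B + 2 * C))).add
    ((hpow (α + 3) (by linarith)).const_mul C)).congr_deriv ?_
  rw [show α + 1 - 1 = α by ring, show α + 2 - 1 = α + 1 by ring,
    show α + 3 - 1 = α + 2 by ring, Real.rpow_add hv, Real.rpow_add hv, Real.rpow_one,
    Real.rpow_two]
  ring

theorem continuous_radialPrim {α : ℝ} (hα : -1 < α) {A B C v : ℝ → ℝ} (hA : Continuous A)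
    (hB : Continuous B) (hC : Continuous C) (hv : Continuous v) :
    Continuous fun t => radialPrim α (A t) (B t) (C t) (v t) := by
  have hpow : ∀ β : ℝ, 0 < β → Continuous fun t => v t ^ β := fun β hβ =>
    hv.rpow_const fun _ => Or.inr hβ.le
  have h1 := hpow (α + 1) (by linarith)
  have h2 := hpow (α + 2) (by linarith)
  have h3 := hpow (α + 3) (by linarith)
  unfold radialPrim
  fun_prop

theorem radialPrim_zero {α : ℝ} (hα : -1 < α) (A B C : ℝ) : radialPrim α A B C 0 = 0 := by
  simp [radialPrim, Real.zero_rpow (show α + 1 ≠ 0 by linarith),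
    Real.zero_rpow (show α + 2 ≠ 0 by linarith), Real.zero_rpow (show α + 3 ≠ 0 by linarith)]

theorem radialPrim_one {α : ℝ} (hα : -1 < α) (A C : ℝ) :
    radialPrim α A 0 C 1 = A / (α + 1) + 2 * C / ((α + 1) * (α + 2) * (α + 3)) := by
  have h1 : α + 1 ≠ 0 := by linarith
  have h2 : α + 2 ≠ 0 := by linarith
  have h3 : α + 3 ≠ 0 := by linarith
  simp only [radialPrim, Real.one_rpow]
  field

theorem integral_cos_two_mul : ∫ θ in (-π)..π, Real.cos (2 * θ) = 0 := by
  rw [intervalIntegral.integral_comp_mul_left _ two_ne_zero, integral_cos]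
  simp [Real.sin_two_pi]

theorem integral_radialPrim_cos (α A b C v : ℝ) :
    ∫ θ in (-π)..π, radialPrim α A (b * Real.cos (2 * θ)) C v = 2 * π * radialPrim α A 0 C v := by
  have hsplit : ∀ θ, radialPrim α A (b * Real.cos (2 * θ)) C v = radialPrim α A 0 C v +
      Real.cos (2 * θ) * (b * (v ^ (α + 1) / (α + 1) - v ^ (α + 2) / (α + 2))) := fun θ => by
    unfold radialPrim
    ring
  simp only [hsplit]
  rw [intervalIntegral.integral_add (by simp) (Continuous.intervalIntegrable (by fun_prop) _ _),
    intervalIntegral.integral_mul_const, integral_cos_two_mul, intervalIntegral.integral_const,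
    smul_eq_mul]
  ring

theorem norm_sq_add_mul_circleMap_sq (x y r θ : ℝ) :
    ‖(x : ℂ) + y * circleMap 0 r θ ^ 2‖ ^ 2 =
      x ^ 2 + 2 * x * y * Real.cos (2 * θ) * r ^ 2 + y ^ 2 * (r ^ 2) ^ 2 := by
  rw [circleMap_zero_pow, ← Complex.normSq_eq_norm_sq, Complex.normSq_apply]
  simp only [Complex.add_re, Complex.add_im, Complex.re_ofReal_mul, Complex.im_ofReal_mul,
    Complex.ofReal_re, Complex.ofReal_im, circleMap_zero_re, circleMap_zero_im, Nat.cast_ofNat]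
  linear_combination y ^ 2 * r ^ 4 * Real.sin_sq_add_cos_sq (2 * θ)

theorem lintegral_quadratic_starRegion {α : ℝ} (hα : -1 < α) (x y : ℝ) {v : ℝ → ℝ}
    (hv : Continuous v) (hv0 : ∀ θ, 0 ≤ v θ) (hv1 : ∀ θ, v θ ≤ 1) :
    ∫⁻ z in starRegion (fun θ => √(1 - v θ)),
        ENNReal.ofReal (‖(x : ℂ) + y * z ^ 2‖ ^ 2 * (1 - ‖z‖ ^ 2) ^ α) =
      ENNReal.ofReal (∫ θ in (-π)..π,
        (radialPrim α (x ^ 2) (2 * x * y * Real.cos (2 * θ)) (y ^ 2) 1 -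
          radialPrim α (x ^ 2) (2 * x * y * Real.cos (2 * θ)) (y ^ 2) (v θ)) / 2) := by
  refine lintegral_starRegion_of_hasDerivAt (by fun_prop) hv.measurable hv1
    (G := fun θ => radialPrim α (x ^ 2) (2 * x * y * Real.cos (2 * θ)) (y ^ 2))
    (g := fun θ t => t ^ α *
      (x ^ 2 + 2 * x * y * Real.cos (2 * θ) * (1 - t) + y ^ 2 * (1 - t) ^ 2))
    ?_ ?_ ?_ ?_ ?_
  · intro θ r _
    rw [norm_sq_add_mul_circleMap_sq, norm_circleMap_zero, sq_abs, sub_sub_cancel, mul_comm]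
  · exact fun θ => (continuous_radialPrim hα continuous_const continuous_const continuous_const
      continuous_id).continuousOn
  · exact fun θ t ht => hasDerivAt_radialPrim hα _ _ _ ((hv0 θ).trans_lt ht.1)
  · intro θ t ht
    have hsq : √(1 - t) ^ 2 = 1 - t := Real.sq_sqrt (by linarith [ht.2])
    have hnorm := norm_sq_add_mul_circleMap_sq x y √(1 - t) θ
    rw [hsq] at hnorm
    rw [← hnorm]
    exact mul_nonneg (Real.rpow_nonneg ((hv0 θ).trans ht.1.le) _) (sq_nonneg _)
  · exact (continuous_radialPrim hα (by fun_prop) (by fun_prop) (by fun_prop) (by fun_prop)).sub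
      (continuous_radialPrim hα (by fun_prop) (by fun_prop) (by fun_prop) hv)

theorem lintegral_quadratic_ball {α : ℝ} (hα : -1 < α) (x y : ℝ) {v : ℝ} (hv0 : 0 ≤ v)
    (hv1 : v ≤ 1) :
    ∫⁻ z in Metric.ball (0 : ℂ) √(1 - v),
        ENNReal.ofReal (‖(x : ℂ) + y * z ^ 2‖ ^ 2 * (1 - ‖z‖ ^ 2) ^ α) =
      ENNReal.ofReal (π * (radialPrim α (x ^ 2) 0 (y ^ 2) 1 -
        radialPrim α (x ^ 2) 0 (y ^ 2) v)) := by
  have hInt : ∀ t : ℝ, IntervalIntegrable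
      (fun θ => radialPrim α (x ^ 2) (2 * x * y * Real.cos (2 * θ)) (y ^ 2) t) volume (-π) π :=
    fun t => (continuous_radialPrim hα (by fun_prop) (by fun_prop) (by fun_prop)
      (by fun_prop)).intervalIntegrable _ _
  rw [← starRegion_const, lintegral_quadratic_starRegion hα x y (v := fun _ => v)
      continuous_const (fun _ => hv0) (fun _ => hv1),
    intervalIntegral.integral_div, intervalIntegral.integral_sub (hInt 1) (hInt v),
    integral_radialPrim_cos, integral_radialPrim_cos]
  congr 1
  ring

theorem lintegral_quadratic_disc {α : ℝ} (hα : -1 < α) (x y : ℝ) :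
    ∫⁻ z in disc, ENNReal.ofReal (‖(x : ℂ) + y * z ^ 2‖ ^ 2 * (1 - ‖z‖ ^ 2) ^ α) =
      ENNReal.ofReal (π * (x ^ 2 / (α + 1) + 2 * y ^ 2 / ((α + 1) * (α + 2) * (α + 3)))) := by
  have hdisc : disc = Metric.ball (0 : ℂ) √(1 - 0) := by simp [disc]
  rw [hdisc, lintegral_quadratic_ball hα x y le_rfl zero_le_one, radialPrim_zero hα,
    radialPrim_one hα, sub_zero]

theorem norm_kernelFun_sq_mul {α : ℝ} (hα : -1 < α) {ω z : ℂ} (hω : ω ∈ disc) (hz : z ∈ disc) :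
    ‖kernelFun α ω z‖ ^ 2 * (1 - ‖z‖ ^ 2) ^ α =
      ((1 - ‖z‖ ^ 2) ^ 2)⁻¹ * ((α + 1) / π * (1 - ‖moebius ω z‖ ^ 2) ^ (α + 2)) := by
  have hden := norm_pos_iff.2 (one_sub_conj_mul_ne_zero hω hz)
  have hω' := one_sub_norm_sq_pos hω
  have hz' := one_sub_norm_sq_pos hz
  have hcoef : 0 ≤ (α + 1) / π := div_nonneg (by linarith) Real.pi_pos.le
  rw [one_sub_norm_moebius_sq hω hz, kernelFun, norm_div, Complex.norm_cpow_real,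
    Complex.norm_real, Real.norm_of_nonneg (by positivity), div_pow, mul_pow, Real.sq_sqrt hcoef,
    Real.div_rpow (by positivity) (by positivity), Real.mul_rpow hω'.le hz'.le,
    Real.rpow_add hz', Real.rpow_two, ← Real.rpow_mul_natCast hω'.le,
    ← Real.rpow_mul_natCast hden.le, ← Real.rpow_natCast_mul hden.le]
  push_cast
  rw [div_mul_cancel₀ _ two_ne_zero, mul_comm (2 : ℝ) (α + 2)]
  field_simp

theorem lintegral_one_sub_norm_sq_rpow_hypMeasure {α : ℝ} (hα : -1 < α) :
    ∫⁻ z, ENNReal.ofReal ((α + 1) / π * (1 - ‖z‖ ^ 2) ^ (α + 2)) ∂hypMeasure = 1 := by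
  have hcoef : 0 ≤ (α + 1) / π := div_nonneg (by linarith) Real.pi_pos.le
  have hα1 : α + 1 ≠ 0 := by linarith
  have hmass := lintegral_quadratic_disc hα √((α + 1) / π) 0
  rw [Real.sq_sqrt hcoef, show π * ((α + 1) / π / (α + 1) +
    2 * 0 ^ 2 / ((α + 1) * (α + 2) * (α + 3))) = 1 by field_simp; simp, ENNReal.ofReal_one] at hmass
  rw [lintegral_hypMeasure (by fun_prop), ← hmass]
  refine setLIntegral_congr_fun measurableSet_disc fun z hz => ?_
  have hz' := one_sub_norm_sq_pos hz
  rw [← ENNReal.ofReal_mul (by positivity), Complex.ofReal_zero, zero_mul, add_zero,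
    Complex.norm_real, Real.norm_of_nonneg (Real.sqrt_nonneg _), Real.sq_sqrt hcoef,
    Real.rpow_add hz', Real.rpow_two]
  congr 1
  field_simp

theorem lintegral_norm_kernelFun_sq {α : ℝ} (hα : -1 < α) {ω : ℂ} (hω : ω ∈ disc) :
    ∫⁻ z in disc, ENNReal.ofReal (‖kernelFun α ω z‖ ^ 2 * (1 - ‖z‖ ^ 2) ^ α) = 1 := by
  have hF : Measurable fun z : ℂ =>
      ENNReal.ofReal ((α + 1) / π * (1 - ‖z‖ ^ 2) ^ (α + 2)) := by fun_prop
  rw [← lintegral_one_sub_norm_sq_rpow_hypMeasure hα, ← lintegral_comp_moebius hF hω,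
    lintegral_hypMeasure (by have := measurable_moebius ω; fun_prop)]
  refine setLIntegral_congr_fun measurableSet_disc fun z hz => ?_
  rw [norm_kernelFun_sq_mul hα hω hz, ENNReal.ofReal_mul (by positivity)]

/-! ### Norms, inner products and the distance to the kernels -/

theorem zero_mem_disc : (0 : ℂ) ∈ disc := by simp [disc]

theorem disc_mem_nhds {z : ℂ} (hz : z ∈ disc) : disc ∈ 𝓝 z := Metric.isOpen_ball.mem_nhds hz

theorem norm_sq_mul_weight_nonneg (α : ℝ) (f : ℂ → ℂ) {z : ℂ} (hz : z ∈ disc) :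
    0 ≤ ‖f z‖ ^ 2 * (1 - ‖z‖ ^ 2) ^ α :=
  mul_nonneg (sq_nonneg _) (Real.rpow_nonneg (one_sub_norm_sq_pos hz).le _)

theorem bergmanNorm_nonneg (α : ℝ) (f : ℂ → ℂ) : 0 ≤ bergmanNorm α f := Real.sqrt_nonneg _

theorem bergmanNorm_sq (α : ℝ) (f : ℂ → ℂ) :
    bergmanNorm α f ^ 2 = ∫ z in disc, ‖f z‖ ^ 2 * (1 - ‖z‖ ^ 2) ^ α :=
  Real.sq_sqrt (setIntegral_nonneg measurableSet_disc fun _ => norm_sq_mul_weight_nonneg α f)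

theorem integrableOn_of_lintegral_eq_ofReal {X : Type*} [MeasurableSpace X] {μ : Measure X}
    {F : X → ℝ} {S : Set X} (hS : MeasurableSet S) (hF : AEStronglyMeasurable F (μ.restrict S))
    (hF0 : ∀ z ∈ S, 0 ≤ F z) {I : ℝ} (h : ∫⁻ z in S, ENNReal.ofReal (F z) ∂μ = ENNReal.ofReal I) :
    IntegrableOn F S μ := by
  refine ⟨hF, ?_⟩
  rw [hasFiniteIntegral_iff_ofReal ((ae_restrict_iff' hS).2 (ae_of_all _ hF0)), h]
  exact ENNReal.ofReal_lt_top

theorem setIntegral_eq_of_lintegral_eq_ofReal {X : Type*} [MeasurableSpace X] {μ : Measure X}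
    {F : X → ℝ} {S : Set X} (hS : MeasurableSet S) (hF : AEStronglyMeasurable F (μ.restrict S))
    (hF0 : ∀ z ∈ S, 0 ≤ F z) {I : ℝ} (hI : 0 ≤ I)
    (h : ∫⁻ z in S, ENNReal.ofReal (F z) ∂μ = ENNReal.ofReal I) : ∫ z in S, F z ∂μ = I := by
  rw [integral_eq_lintegral_of_nonneg_ae ((ae_restrict_iff' hS).2 (ae_of_all _ hF0)) hF, h,
    ENNReal.toReal_ofReal hI]

theorem memBergman_quadratic {α : ℝ} (hα : -1 < α) (x y : ℝ) :
    MemBergman α fun z => (x : ℂ) + y * z ^ 2 :=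
  ⟨by fun_prop, integrableOn_of_lintegral_eq_ofReal measurableSet_disc (by fun_prop)
    (fun _ => norm_sq_mul_weight_nonneg α fun z => (x : ℂ) + y * z ^ 2)
    (lintegral_quadratic_disc hα x y)⟩

theorem bergmanNorm_quadratic_sq {α : ℝ} (hα : -1 < α) (x y : ℝ) :
    bergmanNorm α (fun z => (x : ℂ) + y * z ^ 2) ^ 2 =
      π * (x ^ 2 / (α + 1) + 2 * y ^ 2 / ((α + 1) * (α + 2) * (α + 3))) := by
  have h1 : 0 < α + 1 := by linarith
  have h2 : 0 < α + 2 := by linarith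
  have h3 : 0 < α + 3 := by linarith
  rw [bergmanNorm_sq]
  exact setIntegral_eq_of_lintegral_eq_ofReal measurableSet_disc (by fun_prop)
    (fun _ => norm_sq_mul_weight_nonneg α fun z => (x : ℂ) + y * z ^ 2) (by positivity)
    (lintegral_quadratic_disc hα x y)

theorem differentiableOn_pow_disc (n : ℕ) : DifferentiableOn ℂ (fun z => z ^ n) disc := by
  fun_prop

theorem memBergman_pow {α : ℝ} (hα : -1 < α) (n : ℕ) : MemBergman α fun z => z ^ n := by
  have hone : IntegrableOn (fun z : ℂ => (1 - ‖z‖ ^ 2) ^ α) disc := by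
    simpa using (memBergman_quadratic hα 1 0).2
  refine ⟨differentiableOn_pow_disc n, Integrable.mono' hone (by fun_prop) ?_⟩
  refine (ae_restrict_iff' measurableSet_disc).2 (ae_of_all _ fun z hz => ?_)
  rw [Real.norm_of_nonneg (norm_sq_mul_weight_nonneg α (fun z => z ^ n) hz), norm_pow]
  exact mul_le_of_le_one_left (Real.rpow_nonneg (one_sub_norm_sq_pos hz).le _)
    (pow_le_one₀ (by positivity) (pow_le_one₀ (norm_nonneg z) (mem_disc.1 hz).le))

theorem monomialConst_eq_bergmanNorm_sq (α : ℝ) (n : ℕ) :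
    monomialConst α n = bergmanNorm α (fun z => z ^ n) ^ 2 := by
  simp only [bergmanNorm_sq, monomialConst, norm_pow, ← pow_mul, mul_comm n 2]

theorem monomialConst_zero {α : ℝ} (hα : -1 < α) : monomialConst α 0 = π / (α + 1) := by
  rw [monomialConst_eq_bergmanNorm_sq]
  simpa [div_eq_mul_inv] using bergmanNorm_quadratic_sq hα 1 0

theorem monomialConst_zero_pos {α : ℝ} (hα : -1 < α) : 0 < monomialConst α 0 := by
  rw [monomialConst_zero hα]
  exact div_pos Real.pi_pos (by linarith)

theorem monomialConst_two {α : ℝ} (hα : -1 < α) :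
    monomialConst α 2 = monomialConst α 0 / ((α + 2) * (α + 3) / 2) := by
  have hquad := bergmanNorm_quadratic_sq hα 0 1
  simp only [Complex.ofReal_zero, Complex.ofReal_one, zero_add, one_mul] at hquad
  rw [monomialConst_eq_bergmanNorm_sq, hquad, monomialConst_zero hα]
  have h1 : α + 1 ≠ 0 := by linarith
  have h2 : α + 2 ≠ 0 := by linarith
  have h3 : α + 3 ≠ 0 := by linarith
  field_simp
  simp

theorem monomialConst_two_pos {α : ℝ} (hα : -1 < α) : 0 < monomialConst α 2 := by
  have h2 : 0 < α + 2 := by linarith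
  have h3 : 0 < α + 3 := by linarith
  have h0 := monomialConst_zero_pos hα
  rw [monomialConst_two hα]
  positivity

/-- The weighted Bergman inner product, conjugate linear in the first argument. -/
def bergmanInner (α : ℝ) (f g : ℂ → ℂ) : ℂ :=
  ∫ z in disc, conj (f z) * g z * ((1 - ‖z‖ ^ 2) ^ α : ℝ)

namespace MemBergman

variable {α : ℝ} {f g : ℂ → ℂ}

theorem aestronglyMeasurable (hf : MemBergman α f) :
    AEStronglyMeasurable f (volume.restrict disc) :=
  hf.1.continuousOn.aestronglyMeasurable measurableSet_disc

theorem integrableOn_conj_mul (hf : MemBergman α f) (hg : MemBergman α g) :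
    IntegrableOn (fun z => conj (f z) * g z * ((1 - ‖z‖ ^ 2) ^ α : ℝ)) disc := by
  have hweight : AEStronglyMeasurable (fun z : ℂ => (((1 - ‖z‖ ^ 2) ^ α : ℝ) : ℂ))
      (volume.restrict disc) :=
    (Complex.measurable_ofReal.comp (by fun_prop)).aestronglyMeasurable
  refine Integrable.mono' (hf.2.add hg.2)
    ((Complex.continuous_conj.comp_aestronglyMeasurable hf.aestronglyMeasurable).mul
      hg.aestronglyMeasurable |>.mul hweight) ?_
  refine (ae_restrict_iff' measurableSet_disc).2 (ae_of_all _ fun z hz => ?_)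
  have hw : 0 ≤ (1 - ‖z‖ ^ 2) ^ α := Real.rpow_nonneg (one_sub_norm_sq_pos hz).le α
  rw [norm_mul, norm_mul, RCLike.norm_conj, Complex.norm_real, Real.norm_of_nonneg hw,
    Pi.add_apply, ← add_mul]
  refine mul_le_mul_of_nonneg_right ?_ hw
  nlinarith [two_mul_le_add_sq ‖f z‖ ‖g z‖, sq_nonneg ‖f z‖, sq_nonneg ‖g z‖]

theorem bergmanNorm_sub_mul_sq (hf : MemBergman α f) (hg : MemBergman α g) (c : ℂ) :
    bergmanNorm α (fun z => f z - c * g z) ^ 2 =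
      bergmanNorm α f ^ 2 + ‖c‖ ^ 2 * bergmanNorm α g ^ 2 - 2 * (c * bergmanInner α f g).re := by
  have hcross := (hf.integrableOn_conj_mul hg).const_mul c
  have hexpand : ∀ z : ℂ, ‖f z - c * g z‖ ^ 2 * (1 - ‖z‖ ^ 2) ^ α =
      ‖f z‖ ^ 2 * (1 - ‖z‖ ^ 2) ^ α + ‖c‖ ^ 2 * (‖g z‖ ^ 2 * (1 - ‖z‖ ^ 2) ^ α) -
        2 * (c * (conj (f z) * g z * ((1 - ‖z‖ ^ 2) ^ α : ℝ))).re := fun z => by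
    have hcomm : (f z * conj (c * g z)).re = (c * (conj (f z) * g z)).re := by
      rw [← Complex.conj_re]
      congr 1
      simp only [map_mul, Complex.conj_conj]
      ring
    rw [← mul_assoc c, Complex.re_mul_ofReal, ← Complex.normSq_eq_norm_sq, Complex.normSq_sub,
      Complex.normSq_mul, hcomm]
    simp only [Complex.normSq_eq_norm_sq]
    ring
  simp only [bergmanNorm_sq, hexpand, bergmanInner]
  have hsum : IntegrableOn (fun z => ‖f z‖ ^ 2 * (1 - ‖z‖ ^ 2) ^ α +
      ‖c‖ ^ 2 * (‖g z‖ ^ 2 * (1 - ‖z‖ ^ 2) ^ α)) disc := hf.2.add (hg.2.const_mul _)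
  have hre : IntegrableOn
      (fun z => 2 * (c * (conj (f z) * g z * ((1 - ‖z‖ ^ 2) ^ α : ℝ))).re) disc :=
    hcross.re.const_mul 2
  have hintre : ∫ z in disc, (c * (conj (f z) * g z * ((1 - ‖z‖ ^ 2) ^ α : ℝ))).re =
      (∫ z in disc, c * (conj (f z) * g z * ((1 - ‖z‖ ^ 2) ^ α : ℝ))).re := integral_re hcross
  rw [integral_sub hsum hre, integral_add hf.2 (hg.2.const_mul _),
    integral_const_mul, integral_const_mul, hintre, integral_const_mul]

end MemBergman

theorem intervalIntegral_conj_circleMap_pow_mul {h : ℂ → ℂ} {r : ℝ} (hr : 0 < r)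
    (hh : DifferentiableOn ℂ h (Metric.closedBall 0 r)) (n : ℕ) :
    ∫ θ in (-π)..π, conj (circleMap 0 r θ ^ n) * h (circleMap 0 r θ) =
      r ^ (2 * n) * (2 * π * (iteratedDeriv n h 0 / n.factorial)) := by
  have hcauchy := hh.circleIntegral_one_div_sub_center_pow_smul hr n
  have hintegrand : ∀ θ : ℝ, conj (circleMap 0 r θ ^ n) * h (circleMap 0 r θ) =
      (r ^ (2 * n) * Complex.I⁻¹) * (deriv (circleMap 0 r) θ •
        (1 / (circleMap 0 r θ - 0) ^ (n + 1)) • h (circleMap 0 r θ)) := fun θ => by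
    have hz : circleMap 0 r θ ≠ 0 := circleMap_ne_center hr.ne'
    have hconj : (r : ℂ) ^ 2 = conj (circleMap 0 r θ) * circleMap 0 r θ := by
      rw [Complex.conj_mul', norm_circleMap_zero, ← Complex.ofReal_pow, ← Complex.ofReal_pow,
        sq_abs]
    rw [pow_mul, hconj, deriv_circleMap, smul_eq_mul, smul_eq_mul, sub_zero, mul_pow, map_pow]
    field_simp [Complex.I_ne_zero]
    ring
  have hperiodic : Function.Periodic
      (fun θ => conj (circleMap 0 r θ ^ n) * h (circleMap 0 r θ)) (2 * π) := fun θ => by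
    simp only [periodic_circleMap (0 : ℂ) r θ]
  have hshift := hperiodic.intervalIntegral_add_eq (-π) 0
  rw [show -π + 2 * π = π by ring, zero_add] at hshift
  rw [circleIntegral] at hcauchy
  rw [hshift]
  simp only [hintegrand]
  rw [intervalIntegral.integral_const_mul, hcauchy, smul_eq_mul]
  field_simp [Complex.I_ne_zero]

theorem bergmanInner_pow_left_eq_mul {α : ℝ} (hα : -1 < α) {h : ℂ → ℂ} (hh : MemBergman α h)
    (n : ℕ) :
    bergmanInner α (fun z => z ^ n) h =
      (∫ r in Ioo (0 : ℝ) 1, ((r * (1 - r ^ 2) ^ α * r ^ (2 * n) : ℝ) : ℂ)) *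
        (2 * π * (iteratedDeriv n h 0 / n.factorial)) := by
  rw [bergmanInner, disc,
    setIntegral_ball_eq_polar ((memBergman_pow hα n).integrableOn_conj_mul hh),
    ← integral_mul_const]
  refine setIntegral_congr_fun measurableSet_Ioo fun r hr => ?_
  simp only [norm_circleMap_zero, sq_abs]
  rw [intervalIntegral.integral_mul_const, intervalIntegral_conj_circleMap_pow_mul hr.1
    (hh.1.mono (Metric.closedBall_subset_ball hr.2)), Complex.real_smul]
  push_cast
  ring

theorem bergmanInner_pow_left {α : ℝ} (hα : -1 < α) {h : ℂ → ℂ} (hh : MemBergman α h) (n : ℕ) :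
    bergmanInner α (fun z => z ^ n) h =
      monomialConst α n * (iteratedDeriv n h 0 / n.factorial) := by
  have hself : bergmanInner α (fun z => z ^ n) (fun z => z ^ n) = monomialConst α n := by
    rw [monomialConst, bergmanInner, ← integral_complex_ofReal]
    congr 1
    ext z
    rw [Complex.conj_mul', norm_pow]
    push_cast
    ring
  have hderiv : iteratedDeriv n (fun z : ℂ => z ^ n) 0 = n.factorial := by
    simp [Nat.descFactorial_self]
  rw [← hself, bergmanInner_pow_left_eq_mul hα hh,
    bergmanInner_pow_left_eq_mul hα (memBergman_pow hα n), hderiv,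
    div_self (Nat.cast_ne_zero.2 n.factorial_ne_zero)]
  ring

theorem bergmanInner_quadratic_left {α : ℝ} (hα : -1 < α) (x y : ℝ) {h : ℂ → ℂ}
    (hh : MemBergman α h) :
    bergmanInner α (fun z => (x : ℂ) + y * z ^ 2) h =
      x * (monomialConst α 0 * h 0) + y * (monomialConst α 2 * (iteratedDeriv 2 h 0 / 2)) := by
  have h0 := bergmanInner_pow_left hα hh 0
  have h2 := bergmanInner_pow_left hα hh 2
  simp only [iteratedDeriv_zero, Nat.factorial, Nat.cast_one, div_one, mul_one, Nat.cast_ofNat,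
    Nat.succ_eq_add_one, zero_add, Nat.reduceAdd] at h0 h2
  rw [← h0, ← h2, bergmanInner, bergmanInner, bergmanInner, ← integral_const_mul,
    ← integral_const_mul, ← integral_add
      (((memBergman_pow hα 0).integrableOn_conj_mul hh).const_mul _)
      (((memBergman_pow hα 2).integrableOn_conj_mul hh).const_mul _)]
  congr 1
  ext z
  simp only [map_add, map_mul, map_pow, map_one, Complex.conj_ofReal, pow_zero]
  ring

theorem kernelFun_zero_right (α : ℝ) (ω : ℂ) :
    kernelFun α ω 0 = (√((α + 1) / π) * (1 - ‖ω‖ ^ 2) ^ ((α + 2) / 2) : ℝ) := by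
  simp [kernelFun]

theorem kernelFun_eq_mul_cpow (α : ℝ) (ω z : ℂ) :
    kernelFun α ω z = kernelFun α ω 0 * (1 - conj ω * z) ^ (-((α : ℂ) + 2)) := by
  rw [kernelFun_zero_right, kernelFun, Complex.cpow_neg, div_eq_mul_inv]
  push_cast
  rfl

theorem hasDerivAt_one_sub_conj_mul_cpow {ω z : ℂ} (hω : ω ∈ disc) (hz : z ∈ disc) (b : ℂ) :
    HasDerivAt (fun z => (1 - conj ω * z) ^ (-b))
      (b * conj ω * (1 - conj ω * z) ^ (-(b + 1))) z := by
  have hbase : HasDerivAt (fun z => 1 - conj ω * z) (-conj ω) z := by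
    simpa using ((hasDerivAt_id z).const_mul (conj ω)).const_sub 1
  refine (hbase.cpow_const (Or.inl (re_one_sub_conj_mul_pos hω hz))).congr_deriv ?_
  rw [show -(b + 1) = -b - 1 by ring]
  ring

theorem iteratedDeriv_kernelFun (α : ℝ) {ω : ℂ} (hω : ω ∈ disc) (n : ℕ) {z : ℂ} (hz : z ∈ disc) :
    iteratedDeriv n (kernelFun α ω) z =
      kernelFun α ω 0 * ((∏ i ∈ Finset.range n, ((α : ℂ) + 2 + i)) * conj ω ^ n *
        (1 - conj ω * z) ^ (-((α : ℂ) + 2 + n))) := by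
  induction n generalizing z with
  | zero => simpa using kernelFun_eq_mul_cpow α ω z
  | succ n ih =>
    rw [iteratedDeriv_succ,
      EventuallyEq.deriv_eq (eventually_of_mem (disc_mem_nhds hz) fun _ => ih),
      (((hasDerivAt_one_sub_conj_mul_cpow hω hz _).const_mul _).const_mul _).deriv,
      Finset.prod_range_succ]
    push_cast
    ring_nf

theorem memBergman_kernelFun {α : ℝ} (hα : -1 < α) {ω : ℂ} (hω : ω ∈ disc) :
    MemBergman α (kernelFun α ω) := by
  refine ⟨?_, integrableOn_of_lintegral_eq_ofReal (I := 1) measurableSet_disc ?_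
    (fun _ => norm_sq_mul_weight_nonneg α _)
    (by rw [ENNReal.ofReal_one, lintegral_norm_kernelFun_sq hα hω])⟩
  · refine DifferentiableOn.congr (fun z hz => ?_) fun z _ => kernelFun_eq_mul_cpow α ω z
    exact ((hasDerivAt_one_sub_conj_mul_cpow hω hz _).const_mul
      _).differentiableAt.differentiableWithinAt
  · unfold kernelFun
    fun_prop

theorem bergmanNorm_kernelFun {α : ℝ} (hα : -1 < α) {ω : ℂ} (hω : ω ∈ disc) :
    bergmanNorm α (kernelFun α ω) = 1 := by
  rw [bergmanNorm, setIntegral_eq_of_lintegral_eq_ofReal measurableSet_disc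
    (memBergman_kernelFun hα hω).2.aestronglyMeasurable (fun _ => norm_sq_mul_weight_nonneg α _)
    zero_le_one (by rw [ENNReal.ofReal_one, lintegral_norm_kernelFun_sq hα hω]), Real.sqrt_one]

theorem extremalDist_nonneg (α : ℝ) (f : ℂ → ℂ) : 0 ≤ extremalDist α f := by
  refine Real.sInf_nonneg ?_
  rintro d ⟨c, ω, -, -, rfl⟩
  exact div_nonneg (bergmanNorm_nonneg _ _) (bergmanNorm_nonneg _ _)

theorem extremalDist_eq_of_isGreatest {α : ℝ} (hα : -1 < α) {f : ℂ → ℂ} (hf : MemBergman α f)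
    (hf0 : 0 < bergmanNorm α f) {m : ℝ}
    (hm : IsGreatest ((fun ω => ‖bergmanInner α f (kernelFun α ω)‖) '' disc) m) :
    extremalDist α f = √(2 - 2 * m / bergmanNorm α f) := by
  have hdist : ∀ c : ℂ, ∀ ω ∈ disc, ‖c‖ = bergmanNorm α f →
      bergmanNorm α (fun z => f z - c * kernelFun α ω z) / bergmanNorm α f =
        √(2 - 2 * ((c * bergmanInner α f (kernelFun α ω)).re / bergmanNorm α f) /
          bergmanNorm α f) := by
    intro c ω hω hc
    have hsq := hf.bergmanNorm_sub_mul_sq (memBergman_kernelFun hα hω) c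
    rw [bergmanNorm_kernelFun hα hω, hc] at hsq
    rw [← Real.sqrt_sq (div_nonneg (bergmanNorm_nonneg _ _) hf0.le), div_pow, hsq]
    congr 1
    field
  obtain ⟨⟨ω, hω, rfl⟩, hmax⟩ := hm
  obtain ⟨u, hu, hphase⟩ := RCLike.exists_norm_eq_mul_self (bergmanInner α f (kernelFun α ω))
  have hNu : ‖(bergmanNorm α f : ℂ) * u‖ = bergmanNorm α f := by
    rw [norm_mul, hu, mul_one, Complex.norm_real, Real.norm_of_nonneg hf0.le]
  refine IsLeast.csInf_eq ⟨⟨bergmanNorm α f * u, ω, hNu, hω, ?_⟩, ?_⟩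
  · rw [hdist _ ω hω hNu, mul_assoc, ← hphase, Complex.re_ofReal_mul,
      RCLike.ofReal_eq_complex_ofReal, Complex.ofReal_re, mul_div_cancel_left₀ _ hf0.ne']
  · rintro d ⟨c, w, hc, hw, rfl⟩
    rw [hdist c w hw hc]
    have hle : (c * bergmanInner α f (kernelFun α w)).re / bergmanNorm α f ≤
        ‖bergmanInner α f (kernelFun α ω)‖ := by
      rw [div_le_iff₀' hf0]
      refine le_trans ?_ (mul_le_mul_of_nonneg_left (hmax (mem_image_of_mem _ hw)) hf0.le)
      rw [← hc, ← norm_mul]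
      exact Complex.re_le_norm _
    gcongr

theorem testFun_sq_coeffs {α : ℝ} (hα : -1 < α) (ε : ℝ) :
    (1 / √(monomialConst α 0)) ^ 2 = (α + 1) / π ∧
      (ε / √(monomialConst α 2)) ^ 2 = ε ^ 2 * ((α + 1) * (α + 2) * (α + 3)) / (2 * π) := by
  have h2 : α + 2 ≠ 0 := by linarith
  have h3 : α + 3 ≠ 0 := by linarith
  constructor
  · rw [div_pow, Real.sq_sqrt (monomialConst_zero_pos hα).le, monomialConst_zero hα, one_pow,
      one_div_div]
  · rw [div_pow, Real.sq_sqrt (monomialConst_two_pos hα).le, monomialConst_two hα,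
      monomialConst_zero hα]
    field

theorem memBergman_testFun {α : ℝ} (hα : -1 < α) (ε : ℝ) : MemBergman α (testFun α ε) :=
  memBergman_quadratic hα _ _

theorem bergmanNorm_testFun_sq {α : ℝ} (hα : -1 < α) (ε : ℝ) :
    bergmanNorm α (testFun α ε) ^ 2 = 1 + ε ^ 2 := by
  have h1 : α + 1 ≠ 0 := by linarith
  have h2 : α + 2 ≠ 0 := by linarith
  have h3 : α + 3 ≠ 0 := by linarith
  obtain ⟨hx, hy⟩ := testFun_sq_coeffs hα ε
  refine (bergmanNorm_quadratic_sq hα _ _).trans ?_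
  rw [hx, hy]
  field

theorem bergmanNorm_testFun {α : ℝ} (hα : -1 < α) (ε : ℝ) :
    bergmanNorm α (testFun α ε) = √(1 + ε ^ 2) := by
  rw [← bergmanNorm_testFun_sq hα, Real.sqrt_sq (bergmanNorm_nonneg _ _)]

theorem bergmanNorm_testFun_pos {α : ℝ} (hα : -1 < α) (ε : ℝ) :
    0 < bergmanNorm α (testFun α ε) := by
  rw [bergmanNorm_testFun hα]
  positivity

theorem bergmanInner_testFun_kernelFun {α : ℝ} (hα : -1 < α) (ε : ℝ) {ω : ℂ} (hω : ω ∈ disc) :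
    bergmanInner α (testFun α ε) (kernelFun α ω) =
      ((1 - ‖ω‖ ^ 2) ^ ((α + 2) / 2) : ℝ) *
        (1 + (ε * √((α + 2) * (α + 3) / 2) : ℝ) * conj ω ^ 2) := by
  refine (bergmanInner_quadratic_left hα _ _ (memBergman_kernelFun hα hω)).trans ?_
  rw [iteratedDeriv_kernelFun α hω 2 zero_mem_disc, kernelFun_zero_right]
  have hc0 := monomialConst_zero_pos hα
  have hq : 0 < (α + 2) * (α + 3) / 2 :=
    div_pos (mul_pos (by linarith) (by linarith)) two_pos
  rw [show √((α + 1) / π) = 1 / √(monomialConst α 0) by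
    rw [monomialConst_zero hα, one_div, ← Real.sqrt_inv, inv_div],
    monomialConst_two hα, Real.sqrt_div hc0.le]
  have hq0 := Real.sqrt_pos.2 hq
  have hqc : ((α : ℂ) + 2) * (α + 3) = 2 * √((α + 2) * (α + 3) / 2) ^ 2 := by
    rw [← Complex.ofReal_pow, Real.sq_sqrt hq.le]
    push_cast
    ring
  have hcc : (monomialConst α 0 : ℂ) = √(monomialConst α 0) ^ 2 := by
    rw [← Complex.ofReal_pow, Real.sq_sqrt hc0.le]
  have ha0 := Real.sqrt_pos.2 hc0
  have hac : (√(monomialConst α 0) : ℂ) ≠ 0 := Complex.ofReal_ne_zero.2 ha0.ne'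
  have hgc : (√((α + 2) * (α + 3) / 2) : ℂ) ≠ 0 := Complex.ofReal_ne_zero.2 hq0.ne'
  simp only [one_div, Complex.ofReal_inv, Complex.ofReal_mul, Nat.ofNat_nonneg, Real.sqrt_div',
    Complex.ofReal_div, Complex.ofReal_add, Complex.ofReal_ofNat, Finset.prod_range_succ,
    Finset.range_one, Finset.prod_singleton, CharP.cast_eq_zero, add_zero, Nat.cast_one, mul_zero,
    sub_zero, Nat.cast_ofNat, neg_add_rev, Complex.one_cpow, mul_one]
  rw [hcc, add_assoc, show (2 + 1 : ℂ) = 3 by norm_num, hqc]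
  field

theorem norm_bergmanInner_testFun_kernelFun_le_one {α : ℝ} (hα : -1 < α) {ε : ℝ} (hε0 : 0 ≤ ε)
    (hε1 : ε ≤ 1 / 2) {ω : ℂ} (hω : ω ∈ disc) :
    ‖bergmanInner α (testFun α ε) (kernelFun α ω)‖ ≤ 1 := by
  rw [bergmanInner_testFun_kernelFun hα ε hω]
  set γ := √((α + 2) * (α + 3) / 2)
  set t := ‖ω‖ ^ 2
  have hγ : γ ≤ α + 2 := Real.sqrt_le_iff.2 ⟨by linarith, by nlinarith⟩
  have hγ0 : 0 ≤ γ := Real.sqrt_nonneg _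
  have hεγ : ε * γ ≤ (α + 2) / 2 := by nlinarith
  have ht : 0 < 1 - t := one_sub_norm_sq_pos hω
  have hweight : (1 - t) ^ ((α + 2) / 2) ≤ Real.exp (-t * ((α + 2) / 2)) := by
    rw [Real.exp_mul]
    exact Real.rpow_le_rpow ht.le (Real.one_sub_le_exp_neg t) (by linarith)
  have hfactor : ‖1 + ((ε * γ : ℝ) : ℂ) * conj ω ^ 2‖ ≤ Real.exp (ε * γ * t) :=
    calc
      _ ≤ ‖(1 : ℂ)‖ + ‖((ε * γ : ℝ) : ℂ) * conj ω ^ 2‖ := norm_add_le _ _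
      _ = ε * γ * t + 1 := by
        rw [norm_one, norm_mul, norm_pow, RCLike.norm_conj, Complex.norm_real,
          Real.norm_of_nonneg (mul_nonneg hε0 hγ0), add_comm]
      _ ≤ _ := Real.add_one_le_exp _
  rw [norm_mul, Complex.norm_real, Real.norm_of_nonneg (Real.rpow_nonneg ht.le _)]
  calc
    _ ≤ Real.exp (-t * ((α + 2) / 2)) * Real.exp (ε * γ * t) := by gcongr
    _ = Real.exp ((ε * γ - (α + 2) / 2) * t) := by rw [← Real.exp_add]; ring_nf
    _ ≤ 1 := Real.exp_le_one_iff.2 (mul_nonpos_of_nonpos_of_nonneg (by linarith) (sq_nonneg _))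

theorem extremalDist_testFun {α : ℝ} (hα : -1 < α) {ε : ℝ} (hε0 : 0 ≤ ε) (hε1 : ε ≤ 1 / 2) :
    extremalDist α (testFun α ε) = √(2 - 2 / √(1 + ε ^ 2)) := by
  have hgreatest : IsGreatest
      ((fun ω => ‖bergmanInner α (testFun α ε) (kernelFun α ω)‖) '' disc) 1 := by
    refine ⟨⟨0, zero_mem_disc, ?_⟩, ?_⟩
    · simp [bergmanInner_testFun_kernelFun hα ε zero_mem_disc]
    · rintro _ ⟨ω, hω, rfl⟩
      exact norm_bergmanInner_testFun_kernelFun_le_one hα hε0 hε1 hω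
  rw [extremalDist_eq_of_isGreatest hα (memBergman_testFun hα ε) (bergmanNorm_testFun_pos hα ε)
    hgreatest, bergmanNorm_testFun hα, mul_one]

theorem extremalDist_testFun_sq {α : ℝ} (hα : -1 < α) {ε : ℝ} (hε0 : 0 ≤ ε) (hε1 : ε ≤ 1 / 2) :
    extremalDist α (testFun α ε) ^ 2 = 2 * ε ^ 2 / (√(1 + ε ^ 2) * (√(1 + ε ^ 2) + 1)) := by
  have hN : 1 ≤ √(1 + ε ^ 2) := Real.one_le_sqrt.2 (by nlinarith)
  have hN0 : 0 < √(1 + ε ^ 2) := by positivity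
  have hNsq : √(1 + ε ^ 2) ^ 2 = 1 + ε ^ 2 := Real.sq_sqrt (by positivity)
  rw [extremalDist_testFun hα hε0 hε1, Real.sq_sqrt]
  · field_simp
    linear_combination hNsq
  · rw [sub_nonneg, div_le_iff₀ hN0]
    linarith

theorem extremalDist_testFun_pos {α : ℝ} (hα : -1 < α) {ε : ℝ} (hε0 : 0 < ε) (hε1 : ε ≤ 1 / 2) :
    0 < extremalDist α (testFun α ε) := by
  refine lt_of_pow_lt_pow_left₀ 2 (extremalDist_nonneg _ _) ?_
  rw [extremalDist_testFun_sq hα hε0.le hε1, zero_pow two_ne_zero]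
  positivity

/-! ### The deficit and the exponent of the function estimate -/

theorem radialPrim_le_one {α : ℝ} (hα : -1 < α) {A B C v : ℝ}
    (hpos : ∀ t, 0 ≤ A + B * t + C * t ^ 2) (hv : v ∈ Icc (0 : ℝ) 1) :
    radialPrim α A B C v ≤ radialPrim α A B C 1 := by
  have hmono : MonotoneOn (radialPrim α A B C) (Icc 0 1) := by
    refine monotoneOn_of_hasDerivWithinAt_nonneg
      (f' := fun v => v ^ α * (A + B * (1 - v) + C * (1 - v) ^ 2)) (convex_Icc 0 1)
      (continuous_radialPrim hα continuous_const continuous_const continuous_const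
        continuous_id).continuousOn ?_ ?_ <;>
      rw [interior_Icc]
    · exact fun t ht => (hasDerivAt_radialPrim hα A B C ht.1).hasDerivWithinAt
    · exact fun t ht => mul_nonneg (Real.rpow_nonneg ht.1.le _) (hpos _)
  exact hmono hv (right_mem_Icc.2 zero_le_one) hv.2

theorem add_two_mul_mul_add_sq_nonneg (x y : ℝ) {c : ℝ} (hc : |c| ≤ 1) (t : ℝ) :
    0 ≤ x ^ 2 + 2 * x * y * c * t + y ^ 2 * t ^ 2 := by
  have hc2 : 0 ≤ 1 - c ^ 2 := sub_nonneg.2 ((sq_le_one_iff_abs_le_one c).2 hc)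
  nlinarith [sq_nonneg (x + c * y * t), mul_nonneg hc2 (sq_nonneg (y * t))]

theorem setIntegral_quadratic_starRegion {α : ℝ} (hα : -1 < α) (x y : ℝ) {v : ℝ → ℝ}
    (hv : Continuous v) (hv0 : ∀ θ, 0 ≤ v θ) (hv1 : ∀ θ, v θ ≤ 1) :
    ∫ z in starRegion (fun θ => √(1 - v θ)), ‖(x : ℂ) + y * z ^ 2‖ ^ 2 * (1 - ‖z‖ ^ 2) ^ α =
      bergmanNorm α (fun z => (x : ℂ) + y * z ^ 2) ^ 2 -
        (∫ θ in (-π)..π, radialPrim α (x ^ 2) (2 * x * y * Real.cos (2 * θ)) (y ^ 2) (v θ)) /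
          2 := by
  have hle : ∀ θ, radialPrim α (x ^ 2) (2 * x * y * Real.cos (2 * θ)) (y ^ 2) (v θ) ≤
      radialPrim α (x ^ 2) (2 * x * y * Real.cos (2 * θ)) (y ^ 2) 1 := fun θ =>
    radialPrim_le_one hα (add_two_mul_mul_add_sq_nonneg x y (Real.abs_cos_le_one _))
      ⟨hv0 θ, hv1 θ⟩
  have hInt : ∀ {w : ℝ → ℝ}, Continuous w → IntervalIntegrable (fun θ =>
      radialPrim α (x ^ 2) (2 * x * y * Real.cos (2 * θ)) (y ^ 2) (w θ)) volume (-π) π :=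
    fun hw => (continuous_radialPrim hα continuous_const (by fun_prop) continuous_const
      hw).intervalIntegrable _ _
  rw [setIntegral_eq_of_lintegral_eq_ofReal (measurableSet_starRegion (by fun_prop))
    (by fun_prop) (fun z hz => norm_sq_mul_weight_nonneg α (fun z => (x : ℂ) + y * z ^ 2)
      (starRegion_subset_disc hv0 hz)) ?_ (lintegral_quadratic_starRegion hα x y hv hv0 hv1),
    intervalIntegral.integral_div, intervalIntegral.integral_sub (hInt continuous_const) (hInt hv),
    integral_radialPrim_cos, radialPrim_one hα, bergmanNorm_quadratic_sq hα]
  · ring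
  · exact intervalIntegral.integral_nonneg (by linarith [Real.pi_pos]) fun θ _ => by
      linarith [hle θ]

theorem setIntegral_hypMeasure (α : ℝ) (f : ℂ → ℂ) {Ω : Set ℂ} (hΩ : MeasurableSet Ω)
    (hd : Ω ⊆ disc) :
    ∫ z in Ω, ‖f z‖ ^ 2 * (1 - ‖z‖ ^ 2) ^ (α + 2) ∂hypMeasure =
      ∫ z in Ω, ‖f z‖ ^ 2 * (1 - ‖z‖ ^ 2) ^ α := by
  rw [hypMeasure, setIntegral_withDensity_eq_setIntegral_toReal_smul (by fun_prop)
    (ae_of_all _ fun _ => ENNReal.ofReal_lt_top) _ hΩ, Measure.restrict_restrict hΩ,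
    inter_eq_self_of_subset_left hd]
  refine setIntegral_congr_fun hΩ fun z hz => ?_
  have h := one_sub_norm_sq_pos (hd hz)
  simp only [smul_eq_mul]
  rw [ENNReal.toReal_ofReal (by positivity), Real.rpow_add h, Real.rpow_two]
  field

theorem theta_eq {s : ℝ} (hs : 0 < s) (α : ℝ) :
    theta α s = 1 - (1 + s / π)⁻¹ ^ (α + 1) := by
  have h : 0 < 1 + s / π := by positivity
  rw [theta, show -α - 1 = -(α + 1) by ring, Real.rpow_neg h.le, Real.inv_rpow h.le]

theorem theta_pos {α s : ℝ} (hα : -1 < α) (hs : 0 < s) : 0 < theta α s := by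
  have h : 0 < s / π := by positivity
  rw [theta, sub_pos]
  exact Real.rpow_lt_one_of_one_lt_of_neg (by linarith) (by linarith)

theorem deficit_eq {s : ℝ} (hs : 0 < s) (α : ℝ) (f : ℂ → ℂ) {Ω : Set ℂ} (hΩ : MeasurableSet Ω)
    (hd : Ω ⊆ disc) (hμ : hypMeasure Ω = ENNReal.ofReal s) :
    deficit α f Ω = (bergmanNorm α f ^ 2 * theta α s -
      ∫ z in Ω, ‖f z‖ ^ 2 * (1 - ‖z‖ ^ 2) ^ α) / (bergmanNorm α f ^ 2 * theta α s) := by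
  have hreal : hypMeasure.real Ω = s := by rw [Measure.real, hμ, ENNReal.toReal_ofReal hs.le]
  rw [deficit, hreal, setIntegral_hypMeasure α f hΩ hd]

theorem deficit_quadratic_starRegion {α : ℝ} (hα : -1 < α) (x y : ℝ) {v : ℝ → ℝ}
    (hv : Continuous v) (hv0 : ∀ θ, 0 ≤ v θ) (hv1 : ∀ θ, v θ ≤ 1) {s u : ℝ} (hs : 0 < s)
    (hu : (1 + s / π)⁻¹ = u)
    (hμ : hypMeasure (starRegion fun θ => √(1 - v θ)) = ENNReal.ofReal s) :
    deficit α (fun z => (x : ℂ) + y * z ^ 2) (starRegion fun θ => √(1 - v θ)) =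
      ((∫ θ in (-π)..π, radialPrim α (x ^ 2) (2 * x * y * Real.cos (2 * θ)) (y ^ 2) (v θ)) / 2 -
          bergmanNorm α (fun z => (x : ℂ) + y * z ^ 2) ^ 2 * u ^ (α + 1)) /
        (bergmanNorm α (fun z => (x : ℂ) + y * z ^ 2) ^ 2 * (1 - u ^ (α + 1))) := by
  rw [deficit_eq hs α _ (measurableSet_starRegion (by fun_prop)) (starRegion_subset_disc hv0) hμ,
    setIntegral_quadratic_starRegion hα x y hv hv0 hv1, theta_eq hs, hu]
  ring

theorem measurableSet_centredDisc (s : ℝ) : MeasurableSet (centredDisc s) :=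
  Metric.isOpen_ball.measurableSet

theorem centredDisc_subset_disc {s : ℝ} (hs : 0 < s) : centredDisc s ⊆ disc := by
  refine Metric.ball_subset_ball (Real.sqrt_le_one.2 ?_)
  rw [div_le_one (by positivity)]
  linarith [Real.pi_pos]

theorem deficit_testFun_centredDisc {α : ℝ} (hα : -1 < α) (ε : ℝ) {s u : ℝ} (hs : 0 < s)
    (hu : (1 + s / π)⁻¹ = u) :
    deficit α (testFun α ε) (centredDisc s) =
      ε ^ 2 / (1 + ε ^ 2) * (u ^ (α + 1) * ((α + 1) / 2 * (1 - u) * (α + 4 - (α + 2) * u)) /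
        (1 - u ^ (α + 1))) := by
  have hu01 : u ∈ Ioo (0 : ℝ) 1 := hu ▸ one_add_div_pi_inv_mem_Ioo hs
  have hstar : centredDisc s = starRegion fun _ => √(1 - u) := by
    rw [starRegion_const, centredDisc_eq hs, hu]
  have hnorm : bergmanNorm α (fun z => ((1 / √(monomialConst α 0) : ℝ) : ℂ) +
      ((ε / √(monomialConst α 2) : ℝ) : ℂ) * z ^ 2) ^ 2 = 1 + ε ^ 2 := bergmanNorm_testFun_sq hα ε
  have hdef := deficit_quadratic_starRegion hα (1 / √(monomialConst α 0))
    (ε / √(monomialConst α 2)) (v := fun _ => u) continuous_const (fun _ => hu01.1.le)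
    (fun _ => hu01.2.le) hs hu (hstar ▸ hypMeasure_centredDisc hs)
  obtain ⟨hx, hy⟩ := testFun_sq_coeffs hα ε
  rw [integral_radialPrim_cos, hnorm, hx, hy] at hdef
  rw [hstar]
  refine hdef.trans ?_
  have htheta : 1 - u ^ (α + 1) ≠ 0 := by
    rw [← hu, ← theta_eq hs]
    exact (theta_pos hα hs).ne'
  have h1 : α + 1 ≠ 0 := by linarith
  have h2 : α + 2 ≠ 0 := by linarith
  have h3 : α + 3 ≠ 0 := by linarith
  have hu2 : u ^ (α + 2) = u ^ (α + 1) * u := by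
    rw [← Real.rpow_add_one hu01.1.ne']
    ring_nf
  have hu3 : u ^ (α + 3) = u ^ (α + 1) * u ^ 2 := by
    rw [← Real.rpow_two, ← Real.rpow_add hu01.1]
    ring_nf
  rw [radialPrim, hu2, hu3]
  field

theorem not_eventually_mul_le_sq_rpow {a L M β : ℝ} (ha : 0 < a) (hM : 0 ≤ M) (hβ : 1 / 2 < β) :
    ¬ ∀ᶠ ε in 𝓝[>] (0 : ℝ), a * ε ≤ L * (M * ε ^ 2) ^ β := by
  intro h
  have hpow : Tendsto (fun ε : ℝ => ε ^ (2 * β - 1)) (𝓝[>] 0) (𝓝 0) :=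
    (tendsto_id.mono_left nhdsWithin_le_nhds).rpow_const_nhds_zero (by linarith)
  have hlim : Tendsto (fun ε : ℝ => L * M ^ β * ε ^ (2 * β - 1)) (𝓝[>] 0) (𝓝 0) := by
    simpa only [mul_zero] using hpow.const_mul (L * M ^ β)
  refine ha.not_ge (ge_of_tendsto hlim ?_)
  filter_upwards [h, self_mem_nhdsWithin] with ε hle hε
  have hε : 0 < ε := hε
  have hsq : (ε ^ 2) ^ β = ε ^ (2 * β - 1) * ε := by
    rw [← Real.rpow_natCast_mul hε.le, ← Real.rpow_add_one hε.ne']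
    push_cast
    ring_nf
  refine le_of_mul_le_mul_right ?_ hε
  calc
    a * ε ≤ L * (M * ε ^ 2) ^ β := hle
    _ = L * M ^ β * ε ^ (2 * β - 1) * ε := by rw [Real.mul_rpow hM (sq_nonneg ε), hsq]; ring

theorem mul_rpow_le_abs_mul_rpow {K δ t β : ℝ} (h : |δ| ≤ t) (hβ : 0 ≤ β) :
    K * δ ^ β ≤ |K| * t ^ β :=
  calc
    K * δ ^ β ≤ |K| * |δ ^ β| := (le_abs_self _).trans_eq (abs_mul _ _)
    _ ≤ |K| * |δ| ^ β := by gcongr; exact Real.abs_rpow_le_abs_rpow _ _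
    _ ≤ |K| * t ^ β := by gcongr

theorem sq_lt_extremalDist_testFun_sq_mul {α : ℝ} (hα : -1 < α) {ε : ℝ} (hε0 : 0 < ε)
    (hε1 : ε ≤ 1 / 2) : ε ^ 2 < extremalDist α (testFun α ε) ^ 2 * (1 + ε ^ 2) := by
  have hN : 1 < √(1 + ε ^ 2) := Real.lt_sqrt_of_sq_lt (by nlinarith)
  have hN2 : √(1 + ε ^ 2) ^ 2 = 1 + ε ^ 2 := Real.sq_sqrt (by positivity)
  rw [extremalDist_testFun_sq hα hε0.le hε1, div_mul_eq_mul_div, lt_div_iff₀ (by positivity),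
    mul_right_comm, mul_comm _ (ε ^ 2)]
  exact mul_lt_mul_of_pos_left (by nlinarith) (by positivity)

theorem not_functionEstimate_of_half_lt {α β s : ℝ} (hα : -1 < α) (hβ : 1 / 2 < β) (hs : 0 < s) :
    ¬ ∃ K : ℝ, FunctionEstimate α s K β := by
  rintro ⟨K, hK⟩
  obtain ⟨u, hu⟩ : ∃ u, (1 + s / π)⁻¹ = u := ⟨_, rfl⟩
  set G := u ^ (α + 1) * ((α + 1) / 2 * (1 - u) * (α + 4 - (α + 2) * u)) / (1 - u ^ (α + 1))
    with hG
  refine not_eventually_mul_le_sq_rpow (a := 1 / 2) (L := |K|) (M := |G|) one_half_pos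
    (abs_nonneg _) hβ ?_
  filter_upwards [Ioc_mem_nhdsGT one_half_pos] with ε ⟨hε0, hε1⟩
  have hdist : 1 / 2 * ε ≤ extremalDist α (testFun α ε) := by
    refine le_of_sq_le_sq ?_ (extremalDist_nonneg _ _)
    have hε2 : 1 + ε ^ 2 ≤ 4 := by nlinarith
    have hle := mul_le_mul_of_nonneg_left hε2 (sq_nonneg (extremalDist α (testFun α ε)))
    linarith [sq_lt_extremalDist_testFun_sq_mul hα hε0 hε1]
  have hdeficit : |deficit α (testFun α ε) (centredDisc s)| ≤ |G| * ε ^ 2 := by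
    rw [deficit_testFun_centredDisc hα ε hs hu, ← hG, abs_mul, mul_comm,
      abs_of_nonneg (by positivity : 0 ≤ ε ^ 2 / (1 + ε ^ 2))]
    exact mul_le_mul_of_nonneg_left (div_le_self (sq_nonneg _) (by nlinarith)) (abs_nonneg _)
  calc
    1 / 2 * ε ≤ extremalDist α (testFun α ε) := hdist
    _ ≤ K * deficit α (testFun α ε) (centredDisc s) ^ β :=
      hK _ (measurableSet_centredDisc s) (centredDisc_subset_disc hs) (hypMeasure_centredDisc hs) _
        (memBergman_testFun hα ε) (bergmanNorm_testFun_pos hα ε)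
    _ ≤ |K| * (|G| * ε ^ 2) ^ β := mul_rpow_le_abs_mul_rpow hdeficit (by linarith)

/-! ### The exponent of the set estimate -/

theorem isBigO_second_difference {f : ℝ → ℝ} {x : ℝ} (hf : AnalyticAt ℝ f x) :
    (fun h => 2 * f x - f (x - h) - f (x + h)) =O[𝓝 0] fun h : ℝ => h ^ 2 := by
  obtain ⟨p, hp⟩ := hf
  have hplus : (fun h => f (x + h) - p.partialSum 2 h) =O[𝓝 0] fun h : ℝ => h ^ 2 := by
    simpa only [Real.norm_eq_abs, sq_abs] using hp.isBigO_sub_partialSum_pow 2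
  have hneg : Tendsto (fun h : ℝ => -h) (𝓝 0) (𝓝 0) := by
    simpa only [neg_zero] using tendsto_neg (0 : ℝ)
  have hminus := (hplus.comp_tendsto hneg).congr_right fun h => neg_sq h
  refine (hplus.add hminus).neg_left.congr_left fun h => ?_
  have hlin : p.partialSum 2 h + p.partialSum 2 (-h) = 2 * p.coeff 0 := by
    simp only [FormalMultilinearSeries.partialSum, Finset.sum_range_succ, Finset.range_zero,
      Finset.sum_empty, FormalMultilinearSeries.apply_eq_pow_smul_coeff, smul_eq_mul]
    ring
  have hcoeff : p.coeff 0 = f x := hp.coeff_zero _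
  simp only [Function.comp_apply, ← sub_eq_add_neg]
  linear_combination hlin + 2 * hcoeff

theorem analyticAt_theta (α : ℝ) {s : ℝ} (hs : 0 < s) : AnalyticAt ℝ (theta α) s := by
  have h : 1 + s / π ≠ 0 := by positivity
  exact (contDiffAt_const.sub ((contDiffAt_const.add
    (contDiffAt_id.div_const π)).rpow_const_of_ne h)).analyticAt

theorem hypMeasure_preimage_neg {S : Set ℂ} (hS : MeasurableSet S) :
    hypMeasure ((fun z => -z) ⁻¹' S) = hypMeasure S := by
  have hmoebius : ∀ z, S.indicator (1 : ℂ → ℝ≥0∞) (moebius 0 z) =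
      ((fun z => -z) ⁻¹' S).indicator 1 z := fun z => by
    rw [show moebius 0 z = -z by simp [moebius]]
    rfl
  have h := lintegral_comp_moebius (F := S.indicator 1) (measurable_one.indicator hS) zero_mem_disc
  simp_rw [hmoebius] at h
  rwa [lintegral_indicator_one (measurable_neg hS), lintegral_indicator_one hS] at h

theorem norm_mul_norm_le_of_re_nonpos {x z : ℂ} (hz : z ∈ disc) (h : (conj x * z).re ≤ 0) :
    ‖z‖ * ‖1 - conj x * z‖ ≤ ‖z - x‖ := by
  refine le_of_sq_le_sq ?_ (norm_nonneg _)
  have hsq : ‖z - x‖ ^ 2 - (‖z‖ * ‖1 - conj x * z‖) ^ 2 =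
      (1 - ‖z‖ ^ 2) * (‖x‖ ^ 2 * (1 + ‖z‖ ^ 2) - 2 * (conj x * z).re) := by
    rw [mul_pow]
    simp only [← Complex.normSq_eq_norm_sq, Complex.normSq_apply, Complex.sub_re, Complex.sub_im,
      Complex.mul_re, Complex.mul_im, Complex.conj_re, Complex.conj_im, Complex.one_re,
      Complex.one_im]
    ring
  have hnonneg := mul_nonneg (one_sub_norm_sq_pos hz).le
    (show 0 ≤ ‖x‖ ^ 2 * (1 + ‖z‖ ^ 2) - 2 * (conj x * z).re by
      have : 0 ≤ ‖x‖ ^ 2 * (1 + ‖z‖ ^ 2) := by positivity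
      linarith)
  linarith

theorem centredDisc_mono {s t : ℝ} (hs : 0 < s) (hst : s ≤ t) :
    centredDisc s ⊆ centredDisc t := by
  have hpi := Real.pi_pos
  refine Metric.ball_subset_ball (Real.sqrt_le_sqrt ?_)
  rw [div_le_div_iff₀ (by linarith) (by linarith)]
  nlinarith

theorem hypDisc_radius_le {s : ℝ} (hs : 0 < s) {x : ℂ} (hx : x ∈ disc) {r : ℝ}
    (h : hypMeasure (hypDisc x r) = ENNReal.ofReal s) : r ≤ √(s / (s + π)) := by
  by_contra! hlt
  have hcont : ContinuousAt (fun t : ℝ => √(t / (t + π))) s :=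
    (continuousAt_id.div (by fun_prop) (by positivity)).sqrt
  have hev : ∀ᶠ t in 𝓝[>] s, √(t / (t + π)) < r :=
    (hcont.eventually_lt continuousAt_const hlt).filter_mono nhdsWithin_le_nhds
  obtain ⟨t, htr, hst⟩ := (hev.and self_mem_nhdsWithin).exists
  have hle : hypMeasure (centredDisc t) ≤ hypMeasure (Metric.ball 0 r) :=
    measure_mono (Metric.ball_subset_ball htr.le)
  rw [hypMeasure_centredDisc (hs.trans hst), ← hypMeasure_hypDisc hx, h] at hle
  exact ((ENNReal.ofReal_le_ofReal_iff hs.le).1 hle).not_gt hst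

/-- The annulus of hyperbolic measure `η` just outside `centredDisc s`. -/
def outerRing (s η : ℝ) : Set ℂ := centredDisc (s + η) \ centredDisc s

/-- The set of hyperbolic measure `s` obtained from `centredDisc s` by moving an annulus of
measure `η` across the boundary. It witnesses the sharpness of the set estimate. -/
def ringedDisc (s η : ℝ) : Set ℂ := centredDisc (s - η) ∪ outerRing s η

section RingedDisc

variable {s η : ℝ}

theorem measurableSet_outerRing (s η : ℝ) : MeasurableSet (outerRing s η) :=
  (measurableSet_centredDisc _).diff (measurableSet_centredDisc _)

theorem measurableSet_ringedDisc (s η : ℝ) : MeasurableSet (ringedDisc s η) :=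
  (measurableSet_centredDisc _).union (measurableSet_outerRing s η)

theorem outerRing_subset_disc (hs : 0 < s) (hη : 0 < η) : outerRing s η ⊆ disc :=
  sdiff_subset.trans (centredDisc_subset_disc (by linarith))

theorem ringedDisc_subset_disc (hη : 0 < η) (hηs : η < s) : ringedDisc s η ⊆ disc :=
  union_subset (centredDisc_subset_disc (by linarith)) (outerRing_subset_disc (hη.trans hηs) hη)

theorem disjoint_centredDisc_outerRing (hη : 0 < η) (hηs : η < s) :
    Disjoint (centredDisc (s - η)) (outerRing s η) :=
  disjoint_sdiff_right.mono_left (centredDisc_mono (by linarith) (by linarith))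

theorem hypMeasure_outerRing (hs : 0 < s) (hη : 0 < η) :
    hypMeasure (outerRing s η) = ENNReal.ofReal η := by
  rw [outerRing, measure_sdiff (centredDisc_mono hs (by linarith))
    (measurableSet_centredDisc s).nullMeasurableSet
    (by rw [hypMeasure_centredDisc hs]; exact ENNReal.ofReal_ne_top),
    hypMeasure_centredDisc hs, hypMeasure_centredDisc (by linarith), ← ENNReal.ofReal_sub _ hs.le,
    add_sub_cancel_left]

theorem hypMeasure_ringedDisc (hη : 0 < η) (hηs : η < s) :
    hypMeasure (ringedDisc s η) = ENNReal.ofReal s := by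
  rw [ringedDisc, measure_union (disjoint_centredDisc_outerRing hη hηs)
    (measurableSet_outerRing s η), hypMeasure_outerRing (hη.trans hηs) hη,
    hypMeasure_centredDisc (by linarith), ← ENNReal.ofReal_add (by linarith) hη.le, sub_add_cancel]

theorem outerRing_inter_halfPlane_subset {x : ℂ} {r : ℝ} (hr : r ≤ √(s / (s + π))) :
    outerRing s η ∩ {z | (conj x * z).re ≤ 0} ⊆ symmDiff (ringedDisc s η) (hypDisc x r) := by
  rintro z ⟨hzA, hzH⟩
  refine Or.inl ⟨Or.inr hzA, fun hzB => hzA.2 (mem_ball_zero_iff.2 (lt_of_lt_of_le ?_ hr))⟩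
  exact lt_of_mul_lt_mul_right ((norm_mul_norm_le_of_re_nonpos hzB.1 hzH).trans_lt hzB.2)
    (norm_nonneg _)

theorem outerRing_subset_halfPlane_union_neg (x : ℂ) :
    outerRing s η ⊆ (outerRing s η ∩ {z | (conj x * z).re ≤ 0}) ∪
      (fun z => -z) ⁻¹' (outerRing s η ∩ {z | (conj x * z).re ≤ 0}) := by
  intro z hz
  rcases le_total (conj x * z).re 0 with h | h
  · exact Or.inl ⟨hz, h⟩
  · refine Or.inr ⟨by simpa [outerRing, centredDisc] using hz, ?_⟩
    rw [mem_ofPred_eq, mul_neg, Complex.neg_re]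
    linarith

/-- A pseudohyperbolic disc of the same measure misses, in the half plane facing away from its
centre, the part of the outer ring lying there, which is at least half of the ring. -/
theorem half_le_hypMeasure_symmDiff_ringedDisc (hη : 0 < η) (hηs : η < s) {x : ℂ} (hx : x ∈ disc)
    {r : ℝ} (h : hypMeasure (hypDisc x r) = ENNReal.ofReal s) :
    η / 2 ≤ hypMeasure.real (symmDiff (ringedDisc s η) (hypDisc x r)) := by
  have hs : 0 < s := hη.trans hηs
  have hH : MeasurableSet {z : ℂ | (conj x * z).re ≤ 0} :=
    measurableSet_le (by fun_prop) measurable_const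
  have hmass : ENNReal.ofReal η ≤ 2 * hypMeasure (symmDiff (ringedDisc s η) (hypDisc x r)) :=
    calc
      ENNReal.ofReal η = hypMeasure (outerRing s η) := (hypMeasure_outerRing hs hη).symm
      _ ≤ _ := (measure_mono (outerRing_subset_halfPlane_union_neg x)).trans
        (measure_union_le _ _)
      _ = 2 * hypMeasure (outerRing s η ∩ {z | (conj x * z).re ≤ 0}) := by
        rw [hypMeasure_preimage_neg ((measurableSet_outerRing s η).inter hH), two_mul]
      _ ≤ _ := by
        gcongr
        exact outerRing_inter_halfPlane_subset (hypDisc_radius_le hs hx h)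
  have hfin : hypMeasure (symmDiff (ringedDisc s η) (hypDisc x r)) ≠ ⊤ := by
    refine ne_top_of_le_ne_top ?_
      ((measure_mono symmDiff_subset_union).trans (measure_union_le _ _))
    rw [hypMeasure_ringedDisc hη hηs, h]
    exact ENNReal.add_ne_top.2 ⟨ENNReal.ofReal_ne_top, ENNReal.ofReal_ne_top⟩
  have hreal := ENNReal.toReal_mono (ENNReal.mul_ne_top (by simp) hfin) hmass
  rw [ENNReal.toReal_ofReal hη.le, ENNReal.toReal_mul, ENNReal.toReal_ofNat] at hreal
  rw [Measure.real]
  linarith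

theorem le_asymmetry_ringedDisc (hη : 0 < η) (hηs : η < s) :
    (2 * s)⁻¹ * η ≤ asymmetry (ringedDisc s η) := by
  have hs : 0 < s := hη.trans hηs
  have hμ := hypMeasure_ringedDisc hη hηs
  have hreal : hypMeasure.real (ringedDisc s η) = s := by
    rw [Measure.real, hμ, ENNReal.toReal_ofReal hs.le]
  rw [asymmetry, hreal, hμ]
  refine le_csInf ⟨_, 0, √(s / (s + π)), zero_mem_disc, ?_, rfl⟩ ?_
  · rw [hypMeasure_hypDisc zero_mem_disc]
    exact hypMeasure_centredDisc hs
  · rintro d ⟨x, r, hx, hB, rfl⟩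
    rw [show (2 * s)⁻¹ * η = η / 2 / s by field]
    gcongr
    exact half_le_hypMeasure_symmDiff_ringedDisc hη hηs hx hB

theorem setIntegral_testFun_zero_centredDisc {α t : ℝ} (hα : -1 < α) (ht : 0 < t) :
    ∫ z in centredDisc t, ‖testFun α 0 z‖ ^ 2 * (1 - ‖z‖ ^ 2) ^ α = theta α t := by
  have h := deficit_testFun_centredDisc hα 0 ht rfl
  rw [deficit_eq ht α _ (measurableSet_centredDisc t) (centredDisc_subset_disc ht)
    (hypMeasure_centredDisc ht), bergmanNorm_testFun_sq hα, zero_pow two_ne_zero, zero_div,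
    zero_mul, add_zero, one_mul, div_eq_zero_iff, or_iff_left (theta_pos hα ht).ne',
    sub_eq_zero] at h
  exact h.symm

theorem deficit_ringedDisc {α : ℝ} (hα : -1 < α) (hη : 0 < η) (hηs : η < s) :
    deficit α (testFun α 0) (ringedDisc s η) =
      (2 * theta α s - theta α (s - η) - theta α (s + η)) / theta α s := by
  have hs : 0 < s := hη.trans hηs
  have hInt : ∀ S ⊆ disc, IntegrableOn
      (fun z : ℂ => ‖testFun α 0 z‖ ^ 2 * (1 - ‖z‖ ^ 2) ^ α) S := fun _ hS =>
    (memBergman_testFun hα 0).2.mono_set hS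
  have hring : ∫ z in outerRing s η, ‖testFun α 0 z‖ ^ 2 * (1 - ‖z‖ ^ 2) ^ α =
      theta α (s + η) - theta α s := by
    rw [outerRing, setIntegral_sdiff (measurableSet_centredDisc s)
      (hInt _ (centredDisc_subset_disc (by linarith))) (centredDisc_mono hs (by linarith)),
      setIntegral_testFun_zero_centredDisc hα hs,
      setIntegral_testFun_zero_centredDisc hα (by linarith)]
  rw [deficit_eq hs _ _ (measurableSet_ringedDisc s η) (ringedDisc_subset_disc hη hηs)
    (hypMeasure_ringedDisc hη hηs), bergmanNorm_testFun_sq hα, ringedDisc,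
    setIntegral_union (disjoint_centredDisc_outerRing hη hηs) (measurableSet_outerRing s η)
      (hInt _ (centredDisc_subset_disc (by linarith)))
      (hInt _ (outerRing_subset_disc hs hη)), hring,
    setIntegral_testFun_zero_centredDisc hα (by linarith)]
  congr 1 <;> ring

end RingedDisc

theorem not_setEstimate_of_half_lt {α β s : ℝ} (hα : -1 < α) (hβ : 1 / 2 < β) (hs : 0 < s) :
    ¬ ∃ K : ℝ, SetEstimate α s K β := by
  rintro ⟨K, hK⟩
  have htheta := theta_pos hα hs
  obtain ⟨M, hM, hbound⟩ := (isBigO_second_difference (analyticAt_theta α hs)).exists_nonneg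
  refine not_eventually_mul_le_sq_rpow (a := (2 * s)⁻¹) (L := |K|) (M := M / theta α s)
    (by positivity) (by positivity) hβ ?_
  filter_upwards [nhdsWithin_le_nhds hbound.bound, Ioo_mem_nhdsGT hs] with η hη ⟨hη0, hηs⟩
  have hdeficit : |deficit α (testFun α 0) (ringedDisc s η)| ≤ M / theta α s * η ^ 2 := by
    rw [deficit_ringedDisc hα hη0 hηs, abs_div, abs_of_pos htheta, div_mul_eq_mul_div]
    gcongr
    simpa only [Real.norm_eq_abs, abs_sq] using hη
  calc
    (2 * s)⁻¹ * η ≤ asymmetry (ringedDisc s η) := le_asymmetry_ringedDisc hη0 hηs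
    _ ≤ K * deficit α (testFun α 0) (ringedDisc s η) ^ β :=
      hK _ (measurableSet_ringedDisc s η) (ringedDisc_subset_disc hη0 hηs)
        (hypMeasure_ringedDisc hη0 hηs) _ (memBergman_testFun hα 0) (bergmanNorm_testFun_pos hα 0)
    _ ≤ |K| * (M / theta α s * η ^ 2) ^ β := mul_rpow_le_abs_mul_rpow hdeficit (by linarith)

/-! ### Deformed discs -/

theorem isBigO_one_add_rpow_sub_quadratic (p : ℝ) :
    (fun x : ℝ => (1 + x) ^ p - (1 + p * x + p * (p - 1) / 2 * x ^ 2)) =O[𝓝 0]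
      fun x => x ^ 3 := by
  have h := (Real.one_add_rpow_hasFPowerSeriesAt_zero (a := p)).isBigO_sub_partialSum_pow 3
  have hchoose : Ring.choose p 2 = p * (p - 1) / 2 := by
    have hfactorial := Ring.descPochhammer_eq_factorial_smul_choose p 2
    simp only [descPochhammer_succ_right, descPochhammer_zero, Polynomial.smeval_mul,
      Polynomial.smeval_sub, Polynomial.smeval_X, Polynomial.smeval_one, Nat.factorial_two,
      pow_zero, pow_one, nsmul_eq_mul, one_mul, Nat.cast_zero, Nat.cast_one, Nat.cast_ofNat,
      one_smul, sub_zero] at hfactorial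
    linarith
  refine .of_abs_right ((h.congr_left fun x => ?_).congr_right fun x => (abs_pow x 3).symm)
  simp only [FormalMultilinearSeries.partialSum, Finset.sum_range_succ, Finset.range_zero,
    Finset.sum_empty, binomialSeries_apply, List.ofFn_const, List.prod_replicate, hchoose,
    Ring.choose_zero_right, Ring.choose_one_right, smul_eq_mul, pow_zero, pow_one, zero_add,
    mul_one]

theorem integral_cos_two_mul_sq : ∫ θ in (-π)..π, Real.cos (2 * θ) ^ 2 = π := by
  rw [intervalIntegral.integral_comp_mul_left (fun x => Real.cos x ^ 2) two_ne_zero,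
    integral_cos_sq]
  simp [Real.sin_two_pi]

theorem integral_quadratic_cos (A B C : ℝ) :
    ∫ θ in (-π)..π, (A + B * Real.cos (2 * θ) + C * Real.cos (2 * θ) ^ 2) =
      2 * π * A + π * C := by
  have hInt : ∀ g : ℝ → ℝ, Continuous g → IntervalIntegrable g volume (-π) π := fun g hg =>
    hg.intervalIntegrable _ _
  rw [intervalIntegral.integral_add (hInt _ (by fun_prop)) (hInt _ (by fun_prop)),
    intervalIntegral.integral_add (hInt _ (by fun_prop)) (hInt _ (by fun_prop)),
    intervalIntegral.integral_const_mul, intervalIntegral.integral_const_mul,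
    integral_cos_two_mul, integral_cos_two_mul_sq, intervalIntegral.integral_const, smul_eq_mul]
  ring

/-- The factor of `u^p / p` in the leading term, as `u → 0`, of the mass left outside the region
`1 / (1 - |z|²) < (1 + b cos 2θ) / u` by the function `1 + a b z²`. -/
def leadingMass (p a b : ℝ) : ℝ :=
  (2 * π)⁻¹ * ∫ θ in (-π)..π, (1 + 2 * a * b * Real.cos (2 * θ) + (a * b) ^ 2) *
    (1 + b * Real.cos (2 * θ)) ^ (-p)

theorem abs_mul_cos_le (b t : ℝ) : |b * Real.cos t| ≤ |b| :=
  (abs_mul _ _).trans_le (mul_le_of_le_one_right (abs_nonneg b) (Real.abs_cos_le_one t))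

theorem half_le_one_add_mul_cos {b : ℝ} (hb : |b| ≤ 1 / 2) (t : ℝ) :
    1 / 2 ≤ 1 + b * Real.cos t := by
  linarith [neg_le_of_abs_le ((abs_mul_cos_le b t).trans hb)]

theorem abs_quadratic_mul_taylor_sub_le (p q a : ℝ) {b x R K : ℝ} (hb : |b| ≤ 1) (hx : |x| ≤ |b|)
    (hK : 0 ≤ K) (hR : |R| ≤ K * |x| ^ 3) :
    |(1 + 2 * a * x + a ^ 2 * b ^ 2) * (1 + -p * x + q * x ^ 2 + R) -
        (1 + (2 * a - p) * x + (q - 2 * p * a) * x ^ 2 + a ^ 2 * b ^ 2)| ≤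
      ((1 + |a|) ^ 2 * K + |2 * a * q| + |a ^ 2 * p| + |a ^ 2 * q|) * |b| ^ 3 := by
  have hfactor : |1 + 2 * a * x + a ^ 2 * b ^ 2| ≤ (1 + |a|) ^ 2 := by
    calc
      |1 + 2 * a * x + a ^ 2 * b ^ 2| ≤ |1| + |2 * a * x| + |a ^ 2 * b ^ 2| := abs_add_three _ _ _
      _ = 1 + 2 * |a| * |x| + |a| ^ 2 * |b| ^ 2 := by simp [abs_mul]
      _ ≤ 1 + 2 * |a| * 1 + |a| ^ 2 * 1 := by
        gcongr
        · exact hx.trans hb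
        · exact pow_le_one₀ (abs_nonneg b) hb
      _ = (1 + |a|) ^ 2 := by ring
  have hR3 : |R| ≤ K * |b| ^ 3 := hR.trans (by gcongr)
  have hxxx : |x ^ 3| ≤ |b| ^ 3 := by rw [abs_pow]; gcongr
  have hbbx : |b ^ 2 * x| ≤ |b| ^ 3 := by
    rw [abs_mul, abs_pow, pow_succ |b| 2]
    gcongr
  have hbbxx : |b ^ 2 * x ^ 2| ≤ |b| ^ 3 := by
    rw [abs_mul, abs_pow, abs_pow, pow_succ |b| 2]
    gcongr
    nlinarith [abs_nonneg x]
  calc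
    _ = |(1 + 2 * a * x + a ^ 2 * b ^ 2) * R + 2 * a * q * x ^ 3 - a ^ 2 * p * (b ^ 2 * x) +
          a ^ 2 * q * (b ^ 2 * x ^ 2)| := by ring_nf
    _ ≤ |(1 + 2 * a * x + a ^ 2 * b ^ 2) * R| + |2 * a * q * x ^ 3| + |a ^ 2 * p * (b ^ 2 * x)| +
          |a ^ 2 * q * (b ^ 2 * x ^ 2)| :=
      (abs_add_le _ _).trans (add_le_add_left ((abs_sub _ _).trans
        (add_le_add_left (abs_add_le _ _) _)) _)
    _ ≤ (1 + |a|) ^ 2 * (K * |b| ^ 3) + |2 * a * q| * |b| ^ 3 + |a ^ 2 * p| * |b| ^ 3 +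
          |a ^ 2 * q| * |b| ^ 3 := by
      simp only [abs_mul _ R, abs_mul _ (x ^ 3), abs_mul _ (b ^ 2 * x), abs_mul _ (b ^ 2 * x ^ 2)]
      gcongr
    _ = _ := by ring

theorem integral_eq_leadingMass {p a b x y : ℝ} (hp : p ≠ 0) (hx : x ^ 2 = p / π)
    (hy : y = a * b * x) :
    (∫ θ in (-π)..π, (x ^ 2 + 2 * x * y * Real.cos (2 * θ) + y ^ 2) / p *
      (1 + b * Real.cos (2 * θ)) ^ (-p)) / 2 = leadingMass p a b := by
  rw [leadingMass, ← intervalIntegral.integral_const_mul, ← intervalIntegral.integral_div]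
  congr 1 with θ
  rw [hy, show x ^ 2 + 2 * x * (a * b * x) * Real.cos (2 * θ) + (a * b * x) ^ 2 = x ^ 2 *
    (1 + 2 * a * b * Real.cos (2 * θ) + (a * b) ^ 2) by ring, hx]
  field

theorem continuous_one_add_mul_cos_rpow {b : ℝ} (hb : |b| ≤ 1 / 2) (p : ℝ) :
    Continuous fun θ => (1 + b * Real.cos (2 * θ)) ^ p :=
  Continuous.rpow_const (by fun_prop) fun θ =>
    Or.inl (by linarith [half_le_one_add_mul_cos hb (2 * θ)])

theorem isBigO_leadingMass (p a : ℝ) :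
    (fun b => leadingMass p a b - (1 + (a ^ 2 + (p * (p + 1) / 2 - 2 * p * a) / 2) * b ^ 2))
      =O[𝓝 0] fun b => b ^ 3 := by
  obtain ⟨K, hK, hR⟩ := (isBigO_one_add_rpow_sub_quadratic (-p)).exists_nonneg
  obtain ⟨r, hr, hball⟩ := Metric.eventually_nhds_iff_ball.1 hR.bound
  set q := p * (p + 1) / 2 with hq
  refine Asymptotics.IsBigO.of_bound
    ((1 + |a|) ^ 2 * K + |2 * a * q| + |a ^ 2 * p| + |a ^ 2 * q|) ?_
  filter_upwards [Metric.ball_mem_nhds (0 : ℝ) hr,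
    Metric.closedBall_mem_nhds (0 : ℝ) one_half_pos] with b hbr hb
  rw [mem_closedBall_zero_iff, Real.norm_eq_abs] at hb
  have hbound : ∀ θ, ‖(1 + 2 * a * b * Real.cos (2 * θ) + (a * b) ^ 2) *
      (1 + b * Real.cos (2 * θ)) ^ (-p) - (1 + a ^ 2 * b ^ 2 +
        (2 * a - p) * b * Real.cos (2 * θ) + (q - 2 * p * a) * b ^ 2 * Real.cos (2 * θ) ^ 2)‖ ≤
      ((1 + |a|) ^ 2 * K + |2 * a * q| + |a ^ 2 * p| + |a ^ 2 * q|) * |b| ^ 3 := fun θ => by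
    have hcos := abs_mul_cos_le b (2 * θ)
    have hRθ := hball (b * Real.cos (2 * θ))
      (mem_ball_zero_iff.2 (hcos.trans_lt (mem_ball_zero_iff.1 hbr)))
    rw [Real.norm_eq_abs, Real.norm_eq_abs, abs_pow] at hRθ
    refine (abs_quadratic_mul_taylor_sub_le p q a (by linarith) hcos hK hRθ).trans_eq' ?_
    rw [Real.norm_eq_abs, hq]
    ring_nf
  have hInt : ∀ g : ℝ → ℝ, Continuous g → IntervalIntegrable g volume (-π) π := fun g hg =>
    hg.intervalIntegrable _ _
  have h := intervalIntegral.norm_integral_le_of_norm_le_const (a := -π) (b := π)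
    fun θ _ => hbound θ
  have hpow := continuous_one_add_mul_cos_rpow hb (-p)
  rw [intervalIntegral.integral_sub (hInt _ (by fun_prop)) (hInt _ (by fun_prop)),
    integral_quadratic_cos, show π - -π = 2 * π by ring, abs_of_pos Real.two_pi_pos,
    ← div_le_iff₀ Real.two_pi_pos, Real.norm_eq_abs, ← abs_of_pos Real.two_pi_pos, ← abs_div,
    abs_of_pos Real.two_pi_pos, ← abs_pow] at h
  refine h.trans_eq' (congrArg abs ?_)
  rw [leadingMass]
  field

/-- The region `1 / (1 - |z|²) < (1 + b cos 2θ) / u`, a perturbation of the centred disc of measure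
`π (u⁻¹ - 1)`. To first order in `b` it is a superlevel set of `|f|² (1 - |z|²)^(α + 2)` for
`f = 1 + (α + 2) / 2 * b * z²`, as is optimal for the deficit. -/
def deformedDisc (b u : ℝ) : Set ℂ :=
  starRegion fun θ => √(1 - u / (1 + b * Real.cos (2 * θ)))

theorem continuous_div_one_add_mul_cos {b : ℝ} (hb : |b| ≤ 1 / 2) (u : ℝ) :
    Continuous fun θ => u / (1 + b * Real.cos (2 * θ)) :=
  continuous_const.div (by fun_prop) fun θ => by linarith [half_le_one_add_mul_cos hb (2 * θ)]

theorem div_one_add_mul_cos_mem_Ioc {b u : ℝ} (hb : |b| ≤ 1 / 2) (hu : u ∈ Ioc (0 : ℝ) (1 / 2))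
    (t : ℝ) : u / (1 + b * Real.cos t) ∈ Ioc (0 : ℝ) 1 := by
  have hw := half_le_one_add_mul_cos hb t
  have hw0 : 0 < 1 + b * Real.cos t := by linarith
  exact ⟨div_pos hu.1 hw0, (div_le_one hw0).2 (hu.2.trans hw)⟩

theorem measurableSet_deformedDisc (b u : ℝ) : MeasurableSet (deformedDisc b u) :=
  measurableSet_starRegion (by fun_prop)

theorem deformedDisc_subset_disc {b u : ℝ} (hb : |b| ≤ 1 / 2) (hu : u ∈ Ioc (0 : ℝ) (1 / 2)) :
    deformedDisc b u ⊆ disc :=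
  starRegion_subset_disc fun θ => (div_one_add_mul_cos_mem_Ioc hb hu (2 * θ)).1.le

theorem hypMeasure_deformedDisc {b u : ℝ} (hb : |b| ≤ 1 / 2) (hu : u ∈ Ioc (0 : ℝ) (1 / 2)) :
    hypMeasure (deformedDisc b u) = ENNReal.ofReal (π * (u⁻¹ - 1)) := by
  have hsplit : ∀ θ, ((u / (1 + b * Real.cos (2 * θ)))⁻¹ - 1) / 2 =
      (u⁻¹ - 1) / 2 + u⁻¹ * b / 2 * Real.cos (2 * θ) + 0 * Real.cos (2 * θ) ^ 2 := fun θ => by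
    rw [inv_div]
    ring
  rw [deformedDisc, hypMeasure_starRegion (continuous_div_one_add_mul_cos hb u)
    (fun θ => (div_one_add_mul_cos_mem_Ioc hb hu (2 * θ)).1)
    fun θ => (div_one_add_mul_cos_mem_Ioc hb hu (2 * θ)).2]
  simp only [hsplit, integral_quadratic_cos]
  ring_nf

theorem radialPrim_div (α A B C : ℝ) {u w : ℝ} (hu : 0 < u) (hw : 0 < w) :
    radialPrim α A B C (u / w) = u ^ (α + 1) * ((A + B + C) / (α + 1) * w ^ (-(α + 1)) -
      (B + 2 * C) / (α + 2) * w ^ (-(α + 2)) * u + C / (α + 3) * w ^ (-(α + 3)) * u ^ 2) := by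
  have h2 : u ^ (α + 2) = u ^ (α + 1) * u := by
    rw [← Real.rpow_add_one hu.ne']
    ring_nf
  have h3 : u ^ (α + 3) = u ^ (α + 1) * u ^ 2 := by
    rw [← Real.rpow_add_natCast hu.ne']
    ring_nf
  simp only [radialPrim, Real.div_rpow hu.le hw.le, Real.rpow_neg hw.le, h2, h3]
  ring

theorem tendsto_integral_radialPrim_div (α A C : ℝ) {B w : ℝ → ℝ} (hB : Continuous B)
    (hw : Continuous w) (hw0 : ∀ θ, 0 < w θ) :
    Tendsto (fun u => (∫ θ in (-π)..π, radialPrim α A (B θ) C (u / w θ)) / u ^ (α + 1)) (𝓝[>] 0)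
      (𝓝 (∫ θ in (-π)..π, (A + B θ + C) / (α + 1) * w θ ^ (-(α + 1)))) := by
  have hpow : ∀ q : ℝ, Continuous fun p : ℝ × ℝ => w p.2 ^ q := fun q =>
    (hw.comp continuous_snd).rpow_const fun p => Or.inl (hw0 p.2).ne'
  have hcont : Continuous fun u => ∫ θ in (-π)..π, ((A + B θ + C) / (α + 1) * w θ ^ (-(α + 1)) -
      (B θ + 2 * C) / (α + 2) * w θ ^ (-(α + 2)) * u + C / (α + 3) * w θ ^ (-(α + 3)) * u ^ 2) :=
    intervalIntegral.continuous_parametric_intervalIntegral_of_continuous' (by fun_prop) _ _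
  have hlim := hcont.tendsto 0
  simp only [mul_zero, sub_zero, zero_pow two_ne_zero, add_zero] at hlim
  refine (hlim.mono_left nhdsWithin_le_nhds).congr' ?_
  filter_upwards [self_mem_nhdsWithin] with u hu
  simp only [radialPrim_div α A _ C hu (hw0 _), intervalIntegral.integral_const_mul]
  rw [mul_div_cancel_left₀ _ (Real.rpow_pos_of_pos hu _).ne']

theorem one_add_mul_inv_sub_one_inv (u : ℝ) : (1 + π * (u⁻¹ - 1) / π)⁻¹ = u := by
  rw [mul_div_cancel_left₀ _ Real.pi_ne_zero, add_sub_cancel, inv_inv]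

theorem tendsto_deficit_deformedDisc_div {α ε a b : ℝ} (hα : -1 < α) (hb : |b| ≤ 1 / 2)
    (hab : ε / √(monomialConst α 2) = a * b * (1 / √(monomialConst α 0))) :
    Tendsto (fun u => deficit α (testFun α ε) (deformedDisc b u) / u ^ (α + 1)) (𝓝[>] 0)
      (𝓝 ((leadingMass (α + 1) a b - (1 + ε ^ 2)) / (1 + ε ^ 2))) := by
  set x := 1 / √(monomialConst α 0)
  set y := ε / √(monomialConst α 2)
  have hα0 : 0 < α + 1 := by linarith
  have hw : ∀ θ, 0 < 1 + b * Real.cos (2 * θ) := fun θ => by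
    linarith [half_le_one_add_mul_cos hb (2 * θ)]
  have hmass := tendsto_integral_radialPrim_div α (x ^ 2) (y ^ 2)
    (B := fun θ => 2 * x * y * Real.cos (2 * θ)) (by fun_prop) (by fun_prop) hw
  have hpow : Tendsto (fun u : ℝ => u ^ (α + 1)) (𝓝[>] 0) (𝓝 0) :=
    (tendsto_id.mono_left nhdsWithin_le_nhds).rpow_const_nhds_zero hα0
  have hlim := ((hmass.div_const 2).sub_const (1 + ε ^ 2)).div
    ((hpow.const_sub 1).const_mul (1 + ε ^ 2)) (by positivity)
  rw [integral_eq_leadingMass hα0.ne' (testFun_sq_coeffs hα ε).1 hab, sub_zero, mul_one] at hlim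
  refine hlim.congr' ?_
  filter_upwards [Ioc_mem_nhdsGT one_half_pos] with u hu
  have hs : 0 < π * (u⁻¹ - 1) :=
    mul_pos Real.pi_pos (sub_pos.2 ((one_lt_inv₀ hu.1).2 (by linarith [hu.2])))
  have hdeficit := deficit_quadratic_starRegion hα x y (continuous_div_one_add_mul_cos hb u)
    (fun θ => (div_one_add_mul_cos_mem_Ioc hb hu (2 * θ)).1.le)
    (fun θ => (div_one_add_mul_cos_mem_Ioc hb hu (2 * θ)).2) hs (one_add_mul_inv_sub_one_inv u)
    (hypMeasure_deformedDisc hb hu)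
  rw [show (fun z => (x : ℂ) + y * z ^ 2) = testFun α ε from rfl,
    bergmanNorm_testFun_sq hα] at hdeficit
  rw [deformedDisc, hdeficit, Pi.div_apply]
  have := Real.rpow_pos_of_pos hu.1 (α + 1)
  field

theorem div_sqrt_monomialConst_two {α : ℝ} (hα : -1 < α) {b : ℝ} (hb : 0 ≤ b) :
    b * √((α + 2) / (2 * (α + 3))) / √(monomialConst α 2) =
      (α + 2) / 2 * b * (1 / √(monomialConst α 0)) := by
  have h2 : 0 < α + 2 := by linarith
  have h3 : 0 < α + 3 := by linarith
  refine (pow_left_inj₀ (by positivity) (by positivity) two_ne_zero).1 ?_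
  obtain ⟨hx, hy⟩ := testFun_sq_coeffs hα (b * √((α + 2) / (2 * (α + 3))))
  rw [hy, mul_pow _ (1 / √(monomialConst α 0)), hx, mul_pow, Real.sq_sqrt (by positivity)]
  field

theorem tendsto_leadingMass_sub_div_sq {α : ℝ} (hα : -1 < α) :
    Tendsto (fun b => (leadingMass (α + 1) ((α + 2) / 2) b -
        (1 + (b * √((α + 2) / (2 * (α + 3)))) ^ 2)) / (b * √((α + 2) / (2 * (α + 3)))) ^ 2)
      (𝓝[>] 0) (𝓝 ((α + 1) / 2)) := by
  have h2 : 0 < α + 2 := by linarith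
  have h3 : 0 < α + 3 := by linarith
  have hcubic := (isBigO_leadingMass (α + 1) ((α + 2) / 2)).mono
    (nhdsWithin_le_nhds (s := Ioi (0 : ℝ)))
  have hrem := (hcubic.trans_isLittleO ((Asymptotics.isLittleO_pow_pow
    (show 2 < 3 by norm_num)).mono nhdsWithin_le_nhds)).tendsto_div_nhds_zero
  have hlim := (hrem.const_mul (2 * (α + 3) / (α + 2))).add_const ((α + 1) / 2)
  rw [mul_zero, zero_add] at hlim
  refine hlim.congr' ?_
  filter_upwards [self_mem_nhdsWithin] with b hb
  have hb0 : b ≠ 0 := ne_of_gt hb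
  rw [mul_pow, Real.sq_sqrt (by positivity)]
  field

/-! ### The dependence of the constant on the measure -/

theorem sq_le_of_le_sqrt_mul {D C X δ : ℝ} (hD : 0 < D)
    (h : D ≤ C * √X * δ ^ (1 / 2 : ℝ)) : 0 < X ∧ D ^ 2 ≤ C ^ 2 * X * δ := by
  rw [← Real.sqrt_eq_rpow] at h
  have hX : 0 < X := by
    by_contra! hX
    rw [Real.sqrt_eq_zero_of_nonpos hX] at h
    linarith [mul_zero C, zero_mul (√δ)]
  have hδ : 0 < δ := by
    by_contra! hδ
    rw [Real.sqrt_eq_zero_of_nonpos hδ, mul_zero] at h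
    linarith
  refine ⟨hX, (pow_le_pow_left₀ hD.le h 2).trans_eq ?_⟩
  rw [mul_pow, mul_pow, Real.sq_sqrt hX.le, Real.sq_sqrt hδ.le]

theorem FunctionEstimate.extremalDist_testFun_sq_le {α s c C ε : ℝ} {Ω : Set ℂ} (hα : -1 < α)
    (h : FunctionEstimate α s (C * sigmaConst c α s) (1 / 2)) (hΩ : MeasurableSet Ω)
    (hd : Ω ⊆ disc) (hμ : hypMeasure Ω = ENNReal.ofReal s) (hε0 : 0 < ε) (hε1 : ε ≤ 1 / 2) :
    0 < 1 + (α + 2) / (α + 1) * ((1 + c * (s / π)) ^ (α + 1) - 1) ∧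
      extremalDist α (testFun α ε) ^ 2 ≤
        C ^ 2 * (1 + (α + 2) / (α + 1) * ((1 + c * (s / π)) ^ (α + 1) - 1)) *
          deficit α (testFun α ε) Ω :=
  sq_le_of_le_sqrt_mul (extremalDist_testFun_pos hα hε0 hε1)
    (h Ω hΩ hd hμ _ (memBergman_testFun hα ε) (bergmanNorm_testFun_pos hα ε))

theorem nonneg_of_functionEstimate {α c C : ℝ} (hα : -1 < α)
    (h : ∀ s : ℝ, 0 < s → FunctionEstimate α s (C * sigmaConst c α s) (1 / 2)) : 0 ≤ c := by
  by_contra! hc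
  have hs : 0 < π / -c := div_pos Real.pi_pos (neg_pos.2 hc)
  have hα1 : 0 < α + 1 := by linarith
  have hX := ((h _ hs).extremalDist_testFun_sq_le hα (measurableSet_centredDisc _)
    (centredDisc_subset_disc hs) (hypMeasure_centredDisc hs) one_half_pos le_rfl).1
  have hzero : 1 + c * (π / -c / π) = 0 := by
    have := hc.ne
    field
  rw [hzero, Real.zero_rpow hα1.ne', zero_sub, mul_neg_one, lt_add_neg_iff_add_lt, zero_add,
    div_lt_one hα1] at hX
  linarith

theorem tendsto_rpow_mul_radicand {p c : ℝ} (hp : 0 < p) (hc : 0 ≤ c) (r : ℝ) :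
    Tendsto (fun u => u ^ p * (1 + r * ((1 + c * (u⁻¹ - 1)) ^ p - 1))) (𝓝[>] 0)
      (𝓝 (r * c ^ p)) := by
  have hcont : Continuous fun u : ℝ => u ^ p + r * ((u + c * (1 - u)) ^ p - u ^ p) := by
    have hpow := Real.continuous_rpow_const hp.le
    exact hpow.add ((hpow.comp (by fun_prop : Continuous fun u => u + c * (1 - u))).sub hpow
      |>.const_mul r)
  have hlim := hcont.tendsto 0
  simp only [Real.zero_rpow hp.ne', zero_add, sub_zero, mul_one] at hlim
  refine (hlim.mono_left nhdsWithin_le_nhds).congr' ?_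
  filter_upwards [Ioo_mem_nhdsGT one_pos] with u hu
  have hbase : 1 + c * (u⁻¹ - 1) = (u + c * (1 - u)) / u := by
    have := hu.1.ne'
    field
  have hnum : 0 ≤ u + c * (1 - u) := add_nonneg hu.1.le (mul_nonneg hc (sub_nonneg.2 hu.2.le))
  have hup := Real.rpow_pos_of_pos hu.1 p
  rw [hbase, Real.div_rpow hnum hu.1.le]
  field

/-- The limit of the function estimate on `deformedDisc b u` as `u → 0`. -/
theorem extremalDist_sq_le_of_functionEstimate {α c C ε a b : ℝ} (hα : -1 < α)
    (h : ∀ s : ℝ, 0 < s → FunctionEstimate α s (C * sigmaConst c α s) (1 / 2))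
    (hε0 : 0 < ε) (hε1 : ε ≤ 1 / 2) (hb : |b| ≤ 1 / 2)
    (hab : ε / √(monomialConst α 2) = a * b * (1 / √(monomialConst α 0))) :
    extremalDist α (testFun α ε) ^ 2 ≤ C ^ 2 * ((α + 2) / (α + 1) * c ^ (α + 1)) *
      ((leadingMass (α + 1) a b - (1 + ε ^ 2)) / (1 + ε ^ 2)) := by
  refine ge_of_tendsto (((tendsto_rpow_mul_radicand (by linarith)
    (nonneg_of_functionEstimate hα h) _).const_mul (C ^ 2)).mul
    (tendsto_deficit_deformedDisc_div hα hb hab)) ?_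
  filter_upwards [Ioc_mem_nhdsGT one_half_pos] with u hu
  have hs : 0 < π * (u⁻¹ - 1) :=
    mul_pos Real.pi_pos (sub_pos.2 ((one_lt_inv₀ hu.1).2 (by linarith [hu.2])))
  have hle := ((h _ hs).extremalDist_testFun_sq_le hα (measurableSet_deformedDisc b u)
    (deformedDisc_subset_disc hb hu) (hypMeasure_deformedDisc hb hu) hε0 hε1).2
  rw [mul_div_cancel_left₀ _ Real.pi_ne_zero] at hle
  have hup := (Real.rpow_pos_of_pos hu.1 (α + 1)).ne'
  refine hle.trans_eq ?_
  field

theorem one_le_of_functionEstimate {α c C : ℝ} (hα : -1 < α)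
    (h : ∀ s : ℝ, 0 < s → FunctionEstimate α s (C * sigmaConst c α s) (1 / 2)) :
    1 ≤ C ^ 2 * (α + 2) / 2 * c ^ (α + 1) := by
  have hα1 : 0 < α + 1 := by linarith
  have hα2 : 0 < α + 2 := by linarith
  have hα3 : 0 < α + 3 := by linarith
  set M := C ^ 2 * ((α + 2) / (α + 1) * c ^ (α + 1)) with hM
  have hlim := (tendsto_leadingMass_sub_div_sq hα).const_mul M
  rw [show M * ((α + 1) / 2) = C ^ 2 * (α + 2) / 2 * c ^ (α + 1) by rw [hM]; field] at hlim
  refine ge_of_tendsto hlim ?_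
  filter_upwards [Ioc_mem_nhdsGT one_half_pos] with b hb
  have hb1 : |b| ≤ 1 / 2 := (abs_of_pos hb.1).trans_le hb.2
  have hε0 : 0 < b * √((α + 2) / (2 * (α + 3))) := mul_pos hb.1 (by positivity)
  have hε1 : b * √((α + 2) / (2 * (α + 3))) ≤ 1 / 2 := by
    refine (mul_le_of_le_one_right hb.1.le (Real.sqrt_le_one.2 ?_)).trans hb.2
    rw [div_le_one (by positivity)]
    linarith
  have hab := div_sqrt_monomialConst_two hα hb.1.le
  set ε := b * √((α + 2) / (2 * (α + 3)))
  rw [← mul_div_assoc, le_div_iff₀ (by positivity), one_mul]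
  calc
    ε ^ 2 ≤ extremalDist α (testFun α ε) ^ 2 * (1 + ε ^ 2) :=
      (sq_lt_extremalDist_testFun_sq_mul hα hε0 hε1).le
    _ ≤ M * ((leadingMass (α + 1) ((α + 2) / 2) b - (1 + ε ^ 2)) / (1 + ε ^ 2)) *
          (1 + ε ^ 2) := by
      gcongr
      exact extremalDist_sq_le_of_functionEstimate hα h hε0 hε1 hb1 hab
    _ = M * (leadingMass (α + 1) ((α + 2) / 2) b - (1 + ε ^ 2)) := by field

theorem rpow_neg_inv_le_of_one_le_mul {A c p : ℝ} (hA : 0 < A) (hc : 0 ≤ c) (hp : 0 < p)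
    (h : 1 ≤ A * c ^ p) : A ^ (-(1 / p)) ≤ c := by
  have hAc : A⁻¹ ≤ c ^ p := by
    rwa [inv_le_iff_one_le_mul₀' hA]
  calc
    A ^ (-(1 / p)) = A⁻¹ ^ p⁻¹ := by rw [Real.rpow_neg hA.le, Real.inv_rpow hA.le, one_div]
    _ ≤ (c ^ p) ^ p⁻¹ := by gcongr
    _ = c := Real.rpow_rpow_inv hc hp.ne'

theorem tendsto_one_sub_div_one_sub_rpow {p : ℝ} (hp : p ≠ 0) :
    Tendsto (fun u : ℝ => (1 - u) / (1 - u ^ p)) (𝓝[<] 1) (𝓝 p⁻¹) := by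
  have h := (Real.hasDerivAt_rpow_const (x := 1) (p := p) (Or.inl one_ne_zero)).tendsto_slope
  rw [Real.one_rpow, mul_one] at h
  refine ((h.mono_left (nhdsWithin_mono _ fun u hu => ne_of_lt hu)).inv₀ hp).congr fun u => ?_
  rw [slope_def_field, Real.one_rpow, inv_div, ← neg_sub, ← neg_sub 1, neg_div_neg_eq]

theorem tendsto_deficit_testFun_centredDisc {α : ℝ} (hα : -1 < α) (ε : ℝ) :
    Tendsto (fun u => deficit α (testFun α ε) (centredDisc (π * (u⁻¹ - 1)))) (𝓝[<] 1)
      (𝓝 (ε ^ 2 / (1 + ε ^ 2))) := by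
  have hα1 : α + 1 ≠ 0 := by linarith
  have hcont : Continuous fun u : ℝ => u ^ (α + 1) * ((α + 1) / 2 * (α + 4 - (α + 2) * u)) :=
    (Real.continuous_rpow_const (by linarith)).mul (by fun_prop)
  have hlim := (((hcont.tendsto 1).mono_left nhdsWithin_le_nhds).mul
    (tendsto_one_sub_div_one_sub_rpow hα1)).const_mul (ε ^ 2 / (1 + ε ^ 2))
  rw [Real.one_rpow, show ε ^ 2 / (1 + ε ^ 2) *
    (1 * ((α + 1) / 2 * (α + 4 - (α + 2) * 1)) * (α + 1)⁻¹) = ε ^ 2 / (1 + ε ^ 2) by field] at hlim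
  refine hlim.congr' ?_
  filter_upwards [Ioo_mem_nhdsLT (zero_lt_one' ℝ)] with u hu
  rw [deficit_testFun_centredDisc hα ε (mul_pos Real.pi_pos (sub_pos.2 (one_lt_inv_iff₀.2 hu)))
    (one_add_mul_inv_sub_one_inv u)]
  ring

theorem one_lt_sq_of_functionEstimate {α c C : ℝ} (hα : -1 < α)
    (h : ∀ s : ℝ, 0 < s → FunctionEstimate α s (C * sigmaConst c α s) (1 / 2)) : 1 < C ^ 2 := by
  have hX : Tendsto (fun u : ℝ => 1 + (α + 2) / (α + 1) * ((1 + c * (u⁻¹ - 1)) ^ (α + 1) - 1))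
      (𝓝[<] 1) (𝓝 1) := by
    have hcont : ContinuousAt (fun u : ℝ =>
        1 + (α + 2) / (α + 1) * ((1 + c * (u⁻¹ - 1)) ^ (α + 1) - 1)) 1 := by
      fun_prop (disch := norm_num)
    simpa using hcont.tendsto.mono_left nhdsWithin_le_nhds
  -- On centred discs `Σ(c, α)(s) → 1` as `s → 0`, where `s = π (u⁻¹ - 1)`.
  have hle : extremalDist α (testFun α (1 / 2)) ^ 2 ≤
      C ^ 2 * 1 * ((1 / 2) ^ 2 / (1 + (1 / 2) ^ 2)) := by
    refine ge_of_tendsto ((hX.const_mul (C ^ 2)).mul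
      (tendsto_deficit_testFun_centredDisc hα (1 / 2))) ?_
    filter_upwards [Ioo_mem_nhdsLT (zero_lt_one' ℝ)] with u hu
    have hs := mul_pos Real.pi_pos (sub_pos.2 (one_lt_inv_iff₀.2 hu))
    have hdist := ((h _ hs).extremalDist_testFun_sq_le hα (measurableSet_centredDisc _)
      (centredDisc_subset_disc hs) (hypMeasure_centredDisc hs) one_half_pos le_rfl).2
    rwa [mul_div_cancel_left₀ _ Real.pi_ne_zero] at hdist
  have hlt := sq_lt_extremalDist_testFun_sq_mul hα one_half_pos le_rfl
  norm_num at hle hlt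
  nlinarith

theorem not_eventually_functionEstimate {c : ℝ} (hc : c < 1) (C : ℝ) :
    ¬ ∀ᶠ α : ℝ in atTop, ∀ s : ℝ, 0 < s →
      FunctionEstimate α s (C * sigmaConst c α s) (1 / 2) := by
  intro h
  have hbound : ∀ᶠ n : ℕ in atTop, 0 ≤ c ∧ 1 ≤ C ^ 2 / 2 * ((n + 2) * c ^ (n + 1)) := by
    filter_upwards [tendsto_natCast_atTop_atTop.eventually h] with n hn
    have hα : (-1 : ℝ) < n := by linarith [Nat.cast_nonneg (α := ℝ) n]
    refine ⟨nonneg_of_functionEstimate hα hn, (one_le_of_functionEstimate hα hn).trans_eq ?_⟩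
    rw [← Nat.cast_add_one, Real.rpow_natCast]
    ring
  obtain ⟨-, hc0, -⟩ := hbound.exists
  have hlim : Tendsto (fun n : ℕ => C ^ 2 / 2 * ((n + 2) * c ^ (n + 1))) atTop (𝓝 0) := by
    have hsum := (tendsto_self_mul_const_pow_of_lt_one hc0 hc).add
      ((tendsto_pow_atTop_nhds_zero_of_lt_one hc0 hc).const_mul 2)
    have hmul := (hsum.mul_const c).const_mul (C ^ 2 / 2)
    rw [mul_zero, add_zero, zero_mul, mul_zero] at hmul
    exact hmul.congr fun n => by ring
  exact one_pos.not_ge (ge_of_tendsto hlim (hbound.mono fun _ => And.right))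

/-! ### The limit of small weights -/

theorem tendsto_extremalDist_div :
    Tendsto (fun p : ℝ × ℝ => extremalDist p.1 (testFun p.1 p.2) / p.2)
      (𝓝[>] (-1) ×ˢ 𝓝[>] 0) (𝓝 1) := by
  have hcont : Continuous fun ε : ℝ => √(2 / (√(1 + ε ^ 2) * (√(1 + ε ^ 2) + 1))) :=
    (continuous_const.div (by fun_prop) fun ε => by positivity).sqrt
  have hlim := (hcont.tendsto 0).mono_left (nhdsWithin_le_nhds (s := Ioi 0))
  rw [show √(2 / (√(1 + 0 ^ 2) * (√(1 + 0 ^ 2) + 1))) = 1 by norm_num] at hlim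
  refine (hlim.comp tendsto_snd).congr' ?_
  filter_upwards [prod_mem_prod self_mem_nhdsWithin (Ioc_mem_nhdsGT one_half_pos)]
    with ⟨α, ε⟩ ⟨hα, hε0, hε1⟩
  change √(2 / (√(1 + ε ^ 2) * (√(1 + ε ^ 2) + 1))) = extremalDist α (testFun α ε) / ε
  rw [Real.sqrt_eq_iff_mul_self_eq (by positivity) (div_nonneg (extremalDist_nonneg _ _) hε0.le),
    ← pow_two, div_pow, extremalDist_testFun_sq hα hε0.le hε1]
  have hε : ε ≠ 0 := hε0.ne'
  field

theorem tendsto_rpow_sub_one_div {t : ℝ} (ht : 0 < t) :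
    Tendsto (fun p : ℝ => (t ^ p - 1) / p) (𝓝[≠] 0) (𝓝 (Real.log t)) := by
  have h := (Real.hasStrictDerivAt_const_rpow ht 0).hasDerivAt.tendsto_slope
  rw [Real.rpow_zero, one_mul] at h
  exact h.congr fun p => by rw [slope_def_field, Real.rpow_zero, sub_zero]

/-- The limit of `Σ(1, α)(s)² δ(f_{α,ε}; B_s, α) / ε²` as `α → -1` and `ε → 0`, in terms of
`u = (1 + s / π)⁻¹`. -/
def limitRatio (u : ℝ) : ℝ :=
  (1 - Real.log u) * ((1 - u) * (3 - u) / 2 / -Real.log u)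

theorem limitRatio_mem_Icc {u : ℝ} (hu : u ∈ Ioo 0 1) : limitRatio u ∈ Icc 1 3 := by
  obtain ⟨L, hL⟩ : ∃ L, L = -Real.log u := ⟨_, rfl⟩
  have hL0 : 0 < L := hL ▸ neg_pos.2 (Real.log_neg hu.1 hu.2)
  have hlower : 1 - u ≤ L := by linarith [Real.log_le_sub_one_of_pos hu.1]
  have hupper : u * (1 + L) ≤ 1 := by
    have h := Real.log_le_sub_one_of_pos (inv_pos.2 hu.1)
    rw [Real.log_inv, ← hL, le_sub_iff_add_le', le_inv_comm₀ (by linarith) hu.1] at h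
    rwa [← le_div_iff₀ (by linarith), one_div]
  have heq : limitRatio u = (1 + L) * (1 - u) * (3 - u) / (2 * L) := by
    rw [limitRatio, ← hL, ← neg_neg (Real.log u), ← hL]
    field
  obtain ⟨hu0, hu1⟩ := hu
  rw [mem_Icc, heq, le_div_iff₀ (by positivity), div_le_iff₀ (by positivity)]
  constructor <;> nlinarith [mul_nonneg hL0.le (sub_nonneg.2 hu1.le)]

theorem tendsto_radicand_mul_deficit_div {u : ℝ} (hu : u ∈ Ioo 0 1) :
    Tendsto (fun α : ℝ => (1 + (α + 2) / (α + 1) * (u⁻¹ ^ (α + 1) - 1)) *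
        (u ^ (α + 1) * ((α + 1) / 2 * (1 - u) * (α + 4 - (α + 2) * u)) / (1 - u ^ (α + 1))))
      (𝓝[>] (-1)) (𝓝 (limitRatio u)) := by
  have hshift : Tendsto (fun α : ℝ => α + 1) (𝓝[>] (-1)) (𝓝[≠] 0) := by
    refine tendsto_nhdsWithin_iff.2 ⟨?_, ?_⟩
    · exact ((continuous_add_const 1).tendsto' _ _ (neg_add_cancel 1)).mono_left
        nhdsWithin_le_nhds
    · filter_upwards [self_mem_nhdsWithin] with α hα
      exact (neg_lt_iff_pos_add.1 hα).ne'
  have hX : Tendsto (fun α : ℝ => 1 + (α + 2) * ((u⁻¹ ^ (α + 1) - 1) / (α + 1))) (𝓝[>] (-1))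
      (𝓝 (1 + (-1 + 2) * Real.log u⁻¹)) :=
    ((((continuous_add_const 2).tendsto (-1)).mono_left nhdsWithin_le_nhds).mul
      ((tendsto_rpow_sub_one_div (inv_pos.2 hu.1)).comp hshift)).const_add 1
  have hnum : Continuous fun α : ℝ =>
      u ^ (α + 1) * ((1 - u) * (α + 4 - (α + 2) * u) / 2) :=
    (Continuous.rpow continuous_const (by fun_prop) fun _ => Or.inl hu.1.ne').mul (by fun_prop)
  have hG := ((hnum.tendsto (-1)).mono_left nhdsWithin_le_nhds).div
    ((tendsto_rpow_sub_one_div hu.1).comp hshift).neg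
    (neg_pos.2 (Real.log_neg hu.1 hu.2)).ne'
  have hval : (1 + (-1 + 2) * Real.log u⁻¹) *
      (u ^ (-1 + 1 : ℝ) * ((1 - u) * (-1 + 4 - (-1 + 2) * u) / 2) / -Real.log u) =
        limitRatio u := by
    rw [limitRatio, Real.log_inv, neg_add_cancel, Real.rpow_zero]
    ring
  refine hval ▸ (hX.mul hG).congr' ?_
  filter_upwards [self_mem_nhdsWithin] with α hα
  have hα1 : 0 < α + 1 := neg_lt_iff_pos_add.1 hα
  have hup := (sub_pos.2 (Real.rpow_lt_one hu.1.le hu.2 hα1)).ne'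
  simp only [Function.comp_apply, Pi.div_apply]
  rw [show -((u ^ (α + 1) - 1) / (α + 1)) = (1 - u ^ (α + 1)) / (α + 1) by ring]
  field

theorem tendsto_sigmaConst_mul_deficit {s u : ℝ} (hs : 0 < s) (hu : (1 + s / π)⁻¹ = u) :
    Tendsto (fun p : ℝ × ℝ => sigmaConst 1 p.1 s *
        deficit p.1 (testFun p.1 p.2) (centredDisc s) ^ (1 / 2 : ℝ) / p.2)
      (𝓝[>] (-1) ×ˢ 𝓝[>] 0) (𝓝 √(limitRatio u)) := by
  have hden : Tendsto (fun ε : ℝ => 1 + ε ^ 2) (𝓝[>] 0) (𝓝 1) :=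
    ((by fun_prop : Continuous fun ε : ℝ => 1 + ε ^ 2).tendsto' _ _ (by norm_num)).mono_left
      nhdsWithin_le_nhds
  have hlim := (((tendsto_radicand_mul_deficit_div (hu ▸ one_add_div_pi_inv_mem_Ioo hs)).comp
    (tendsto_fst (g := 𝓝[>] (0 : ℝ)))).div (hden.comp tendsto_snd) one_ne_zero).sqrt
  rw [div_one] at hlim
  refine hlim.congr' ?_
  filter_upwards [prod_mem_prod self_mem_nhdsWithin self_mem_nhdsWithin]
    with ⟨α, ε⟩ ⟨hα, hε⟩
  have hα1 : 0 < α + 1 := neg_lt_iff_pos_add.1 hα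
  have hε0 : 0 < ε := hε
  have hbase : 1 ≤ 1 + 1 * (s / π) := by linarith [div_pos hs Real.pi_pos]
  have hX : 0 ≤ 1 + (α + 2) / (α + 1) * ((1 + 1 * (s / π)) ^ (α + 1) - 1) :=
    add_nonneg zero_le_one (mul_nonneg (div_nonneg (by linarith) hα1.le)
      (sub_nonneg.2 (Real.one_le_rpow hbase hα1.le)))
  simp only [Function.comp_apply, Pi.div_apply]
  rw [← Real.sqrt_eq_rpow, sigmaConst, ← Real.sqrt_mul hX, eq_div_iff hε0.ne',
    ← Real.sqrt_mul_self hε0.le, ← Real.sqrt_mul' _ (mul_self_nonneg ε), Real.sqrt_mul_self hε0.le,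
    deficit_testFun_centredDisc hα ε hs hu, one_mul (s / π), ← inv_inv (1 + s / π), hu]
  congr 1
  ring

end BergmanStability

end

open BergmanStability in
theorem mainTheorem5 :
    -- (i) the exponent `1/2` is optimal in both estimates
    (∀ α : ℝ, -1 < α → ∀ β : ℝ, 1 / 2 < β → ∀ s : ℝ, 0 < s →
      (¬ ∃ K : ℝ, FunctionEstimate α s K β) ∧ (¬ ∃ K : ℝ, SetEstimate α s K β)) ∧
    -- (ii) dependence of the constant on `s`, for large `α` and for each `α`
    (∀ c : ℝ, c < 1 → ∀ C : ℝ,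
      ¬ ∀ᶠ α : ℝ in Filter.atTop, ∀ s : ℝ, 0 < s →
        FunctionEstimate α s (C * sigmaConst c α s) (1 / 2)) ∧
    (∀ α : ℝ, -1 < α → ∀ c C : ℝ, 0 < C →
      (∀ s : ℝ, 0 < s → FunctionEstimate α s (C * sigmaConst c α s) (1 / 2)) →
        (C ^ 2 * (α + 2) / 2) ^ (-(1 / (α + 1))) ≤ c) ∧
    (∀ α : ℝ, -1 < α → ∀ c : ℝ,
      (∀ s : ℝ, 0 < s → FunctionEstimate α s (sigmaConst c α s) (1 / 2)) →
        (Real.pi * (α + 2) / (α + 1)) ^ (-(1 / (α + 1))) ≤ c) ∧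
    -- (iii) sharpness as `α → -1`
    (∃ a b : ℝ, 0 < a ∧ ∀ s : ℝ, 0 < s →
      hypMeasure (centredDisc s) = ENNReal.ofReal s ∧
      (∀ α ε : ℝ, -1 < α → MemBergman α (testFun α ε) ∧ 0 < bergmanNorm α (testFun α ε)) ∧
      Filter.Tendsto (fun p : ℝ × ℝ => extremalDist p.1 (testFun p.1 p.2) / p.2)
        (nhdsWithin (-1) (Set.Ioi (-1)) ×ˢ nhdsWithin 0 (Set.Ioi 0)) (nhds 1) ∧
      ∃ κ : ℝ, a ≤ κ ∧ κ ≤ b ∧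
        Filter.Tendsto (fun p : ℝ × ℝ => sigmaConst 1 p.1 s *
            deficit p.1 (testFun p.1 p.2) (centredDisc s) ^ (1 / 2 : ℝ) / p.2)
          (nhdsWithin (-1) (Set.Ioi (-1)) ×ˢ nhdsWithin 0 (Set.Ioi 0)) (nhds κ)) := by
  refine ⟨fun α hα β hβ s hs =>
      ⟨not_functionEstimate_of_half_lt hα hβ hs, not_setEstimate_of_half_lt hα hβ hs⟩,
    fun c hc C => not_eventually_functionEstimate hc C, fun α hα c C hC h => ?_,
    fun α hα c h => absurd (one_lt_sq_of_functionEstimate (C := 1) hα (by simpa using h))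
      (by norm_num),
    1, √3, one_pos, fun s hs => ⟨hypMeasure_centredDisc hs,
      fun α ε hα => ⟨memBergman_testFun hα ε, bergmanNorm_testFun_pos hα ε⟩,
      tendsto_extremalDist_div, _, ?_, ?_, tendsto_sigmaConst_mul_deficit hs rfl⟩⟩
  · have hα2 : 0 < α + 2 := by linarith
    exact rpow_neg_inv_le_of_one_le_mul (by positivity) (nonneg_of_functionEstimate hα h)
      (by linarith) (one_le_of_functionEstimate hα h)
  · exact Real.one_le_sqrt.2 (limitRatio_mem_Icc (one_add_div_pi_inv_mem_Ioo hs)).1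
  · exact Real.sqrt_le_sqrt (limitRatio_mem_Icc (one_add_div_pi_inv_mem_Ioo hs)).2
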